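/- Let $\mathcal O_0=\mathbb C\{x,y\}$, let $\nu_0$ denote the order at $0$, and for $f\in\mathcal O_0$ let $f^\vee(x,y)=\overline{f(\bar x,\bar y)}$. Let $$\eta=\sum_{i=1}^r\lambda_i\frac{df_i}{f_i}+\alpha$$ be a logarithmic $1$-form at $(\mathbb C^2,0)$: the $f_i\in\mathcal O_0$ are irreducible equations of pairwise distinct branches, $\lambda_i\in\mathbb C^*$, and $\alpha$ is a closed germ of holomorphic $1$-form. Put $f=f_1\cdots f_r$ and $\nu_i=\nu_0(f_i)$. Assume that $\eta$ is * *main resonant*: $\sum_i\nu_i\lambda_i=0$; * *1-faithful*: $\nu_0(f\eta)=\nu_0(f)-1$; * *symmetric*: $\alpha$ has real coefficients, and for every $i$ there is $j$ such that $f_i^\vee=0$ and $f_j=0$ define the same branch and $\lambda_j=\overline{\lambda_i}$. **Notation.** Let $\sigma$ be the blow-up of $0\in\mathbb C^2$, with divisor $D=\sigma^{-1}(0)\cong\mathbb P^1_{\mathbb C}$ (the lines through $0$), whose real trace is the set of the real lines. A point $p\in D$ is an *escape point* of a logarithmic form $\eta$ if it does not lie in the tangent cone of the polar set of $\eta$ and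 the strict transform by $\sigma$ of the foliation defined by $\eta$ is not transversal to $D$ at $p$ (it is singular at $p$ or tangent to $D$ at $p$). Given real linear coordinates $(x',y')$ of $\mathbb C^2$, let $t=y'/x'$ be the affine coordinate of $D$, let $a_1,\dots,a_\ell\in\mathbb C$ be the distinct affine points of the tangent cone of the polar set, let $\rho_k$ be the sum of the $\lambda_i\nu_i$ over the $f_i$ with tangent $t=a_k$, and let $P_\eta(t)=\sum_k\rho_k\prod_{j\ne k}(t-a_j)$, the numerator of the escape function $R_\eta(t)=\sum_k\rho_k/(t-a_k)$. The coordinates are *adapted* to $\eta$ if no $f_i$ is tangent to the $y'$-axis and $P_\eta$ is nonzero of degree $\ell-2$. A *1-logarithmic modification* of $\eta$ with parameters $\tau=\{(a_1',\lambda_1'),\dots,(a_s',\lambda_s')\}$, where the $a_i'\in\mathbb C\setminus\{a_1,\dots,a_\ell\}$ are distinct and $\lambda_i'\in\mathbb C^*$, is a form $\eta^\tau=\eta+\sum_{i=1}^s\lambda_i'\,df_i'/f_i'$, where $f_i'\in\mathcal O_0$ is an equation of a smooth branch with tangent $t=a_i'$. It is *symmetric* if $\tau$ is invariant by complex conjugation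 and $\{f_1',\dots,f_s'\}$ is invariant by $f\mapsto f^\vee$; it is *balanced* if $\sum_i\lambda_i'=0$ and $P_{\eta^\tau}$ is nonzero of degree $\ell+s-2$. **Statement.** Real linear coordinates adapted to $\eta$ exist. In any such coordinates, for every $\varepsilon>0$ there is a non-empty finite set of parameters $\tau=\{(a_i',\lambda_i')\}$ as above with $a_i'\in\mathbb R$, $\lambda_i'\in\mathbb Q^*$ and $|\lambda_i'|<\varepsilon$, such that symmetric 1-logarithmic modifications $\eta^\tau$ of $\eta$ with parameters $\tau$ exist, and every one of them is balanced and has no escape points in the real trace of $D$. -/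

import Mathlib

noncomputable section

namespace LogModel

/-- Formal power series in two variables; `X 0 = x`, `X 1 = y`. -/
abbrev Ser : Type := MvPowerSeries (Fin 2) ℂ

/-- Geometric growth of the coefficients, i.e. convergence on some polydisc around the origin. -/
def Converges (f : Ser) : Prop :=
  ∃ C R : ℝ, ∀ n : Fin 2 →₀ ℕ, ‖MvPowerSeries.coeff n f‖ ≤ C * R ^ (n 0 + n 1)

theorem Converges.good {f : Ser} (hf : Converges f) :
    ∃ C R : ℝ, 0 ≤ C ∧ 1 ≤ R ∧
      ∀ n : Fin 2 →₀ ℕ, ‖MvPowerSeries.coeff n f‖ ≤ C * R ^ (n 0 + n 1) := by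
  obtain ⟨C, R, h⟩ := hf
  refine ⟨|C|, max 1 |R|, abs_nonneg _, le_max_left _ _, fun n => (h n).trans ?_⟩
  calc C * R ^ (n 0 + n 1) ≤ |C * R ^ (n 0 + n 1)| := le_abs_self _
    _ = |C| * |R| ^ (n 0 + n 1) := by rw [abs_mul, abs_pow]
    _ ≤ _ := by
      gcongr
      exact le_max_right _ _

theorem Converges.mul {f g : Ser} (hf : Converges f) (hg : Converges g) : Converges (f * g) := by
  obtain ⟨C, R, hC, hR, hf⟩ := hf.good
  obtain ⟨D, S, hD, hS, hg⟩ := hg.good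
  refine ⟨C * D, 2 * (R * S), fun n => ?_⟩
  have hcard : (Finset.HasAntidiagonal.antidiagonal n).card ≤ (n 0 + 1) * (n 1 + 1) := by
    rw [← Finset.card_range (n 0 + 1), ← Finset.card_range (n 1 + 1), ← Finset.card_product]
    refine Finset.card_le_card_of_injOn (fun p => (p.1 0, p.1 1)) ?_ ?_
    · intro p hp
      have hp' := Finset.HasAntidiagonal.mem_antidiagonal.1 hp
      have h0 := DFunLike.congr_fun hp' 0
      have h1 := DFunLike.congr_fun hp' 1
      simp only [Finsupp.add_apply] at h0 h1
      simp only [Finset.coe_product, Set.mem_prod, Finset.coe_range, Set.mem_Iio]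
      omega
    · intro p hp q hq hpq
      have hp' := Finset.HasAntidiagonal.mem_antidiagonal.1 hp
      have hq' := Finset.HasAntidiagonal.mem_antidiagonal.1 hq
      simp only [Prod.mk.injEq] at hpq
      have h1 : p.1 = q.1 := by
        ext k
        fin_cases k
        · exact hpq.1
        · exact hpq.2
      refine Prod.ext h1 ?_
      rw [h1] at hp'
      exact add_left_cancel (hp'.trans hq'.symm)
  have hcard2 : ((Finset.HasAntidiagonal.antidiagonal n).card : ℝ) ≤ 2 ^ (n 0 + n 1) := by
    have h : (n 0 + 1) * (n 1 + 1) ≤ 2 ^ (n 0 + n 1) := by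
      rw [pow_add]
      exact Nat.mul_le_mul (Nat.lt_two_pow_self) (Nat.lt_two_pow_self)
    exact_mod_cast hcard.trans h
  rw [MvPowerSeries.coeff_mul]
  refine (norm_sum_le _ _).trans ?_
  have hterm : ∀ p ∈ Finset.HasAntidiagonal.antidiagonal n,
      ‖MvPowerSeries.coeff p.1 f * MvPowerSeries.coeff p.2 g‖
        ≤ C * D * (R * S) ^ (n 0 + n 1) := by
    intro p hp
    have hp' := Finset.HasAntidiagonal.mem_antidiagonal.1 hp
    have h0 := DFunLike.congr_fun hp' 0
    have h1 := DFunLike.congr_fun hp' 1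
    simp only [Finsupp.add_apply] at h0 h1
    rw [norm_mul]
    calc _ ≤ (C * R ^ (p.1 0 + p.1 1)) * (D * S ^ (p.2 0 + p.2 1)) :=
          mul_le_mul (hf _) (hg _) (norm_nonneg _) (by positivity)
      _ ≤ (C * R ^ (n 0 + n 1)) * (D * S ^ (n 0 + n 1)) := by
          gcongr <;> first | assumption | omega
      _ = _ := by rw [mul_pow]; ring
  refine (Finset.sum_le_card_nsmul _ _ _ hterm).trans ?_
  rw [nsmul_eq_mul]
  calc _ ≤ 2 ^ (n 0 + n 1) * (C * D * (R * S) ^ (n 0 + n 1)) := by gcongr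
    _ = _ := by rw [mul_pow 2 (R * S)]; ring

theorem Converges.add {f g : Ser} (hf : Converges f) (hg : Converges g) : Converges (f + g) := by
  obtain ⟨C, R, hC, hR, hf⟩ := hf.good
  obtain ⟨D, S, hD, hS, hg⟩ := hg.good
  refine ⟨C + D, R * S, fun n => ?_⟩
  rw [map_add]
  refine (norm_add_le _ _).trans ?_
  rw [add_mul]
  refine add_le_add ((hf n).trans ?_) ((hg n).trans ?_)
  · gcongr
    nlinarith
  · gcongr
    nlinarith

theorem converges_C (c : ℂ) : Converges (MvPowerSeries.C c) := by
  refine ⟨‖c‖, 1, fun n => ?_⟩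
  rw [MvPowerSeries.coeff_C]
  split_ifs <;> simp

/-- The ring `𝒪₀ = ℂ{x, y}` of germs of holomorphic functions at the origin of `ℂ²`. -/
def O : Subring Ser where
  carrier := {f | Converges f}
  mul_mem' := Converges.mul
  one_mem' := by simpa using converges_C 1
  add_mem' := Converges.add
  zero_mem' := by simpa using converges_C 0
  neg_mem' := by
    rintro f ⟨C, R, h⟩
    exact ⟨C, R, fun n => by rw [map_neg, norm_neg]; exact h n⟩

/-- The germ `f^∨`, with `f^∨(x, y)` the conjugate of `f` at the conjugate point. -/
def conj (f : O) : O :=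
  ⟨MvPowerSeries.map (starRingEnd ℂ) (f : Ser), by
    obtain ⟨C, R, h⟩ := f.2
    exact ⟨C, R, fun n => by
      rw [MvPowerSeries.coeff_map, RCLike.norm_conj]; exact h n⟩⟩

/-- The order `ν₀(f)`, for nonzero `f`. -/
def ord (f : O) : ℕ := (f : Ser).order.toNat

/-- The initial form of `f`: its homogeneous component of degree `ν₀(f)`. Its zero lines are the
tangent cone of the curve `f = 0`. -/
def initForm (f : O) : MvPolynomial (Fin 2) ℂ :=
  ∑ p ∈ Finset.HasAntidiagonal.antidiagonal (ord f),
    MvPolynomial.monomial (Finsupp.single 0 p.1 + Finsupp.single 1 p.2)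
      (MvPowerSeries.coeff (Finsupp.single 0 p.1 + Finsupp.single 1 p.2) (f : Ser))

/-- A logarithmic `1`-form `η = ∑ i, res i • d(f i) / (f i) + α`, where the `f i` are irreducible
equations of distinct branches, the residues are nonzero and `α = αx dx + αy dy` is holomorphic
and closed. -/
structure LogForm (ι : Type*) where
  f : ι → O
  res : ι → ℂ
  αx : O
  αy : O
  irreducible : ∀ i, Irreducible (f i)
  distinct : ∀ i j, i ≠ j → ¬ Associated (f i) (f j)
  res_ne_zero : ∀ i, res i ≠ 0
  closed : MvPowerSeries.pderiv ℂ 1 (αx : Ser) = MvPowerSeries.pderiv ℂ 0 (αy : Ser)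

namespace LogForm

variable {ι : Type*} [Fintype ι]

/-- The product `f` of the equations of the poles. -/
def F (η : LogForm ι) : Ser := ∏ i, (η.f i : Ser)

/-- The part along the `k`-th coordinate of
`∑ i, res i • (∏ j ≠ i, f j) d(f i)`. -/
def polarPart (η : LogForm ι) (k : Fin 2) : Ser :=
  open Classical in
  ∑ i, η.res i • ((∏ j ∈ Finset.univ.erase i, (η.f j : Ser)) *
    MvPowerSeries.pderiv ℂ k (η.f i : Ser))

/-- The coefficient of `dx` in the holomorphic `1`-form `ω = f η`. -/
def ωx (η : LogForm ι) : Ser := η.polarPart 0 + η.F * (η.αx : Ser)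

/-- The coefficient of `dy` in the holomorphic `1`-form `ω = f η`. -/
def ωy (η : LogForm ι) : Ser := η.polarPart 1 + η.F * (η.αy : Ser)

/-- The weighted balance of residues vanishes. -/
def MainResonant (η : LogForm ι) : Prop := ∑ i, (ord (η.f i) : ℂ) * η.res i = 0

/-- `ν₀(f η) = ν₀(f) - 1`. -/
def OneFaithful (η : LogForm ι) : Prop :=
  min η.ωx.order η.ωy.order + 1 = η.F.order

/-- The set of poles, the residues and `α` are invariant by complex conjugation. -/
def IsSymmetric (η : LogForm ι) : Prop :=
  (∀ i, ∃ j, Associated (conj (η.f i)) (η.f j) ∧ η.res j = starRingEnd ℂ (η.res i)) ∧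
    conj η.αx = η.αx ∧ conj η.αy = η.αy

end LogForm

/-! ### Points of the divisor, transversality, escape points

Points of the divisor `D` of the blow-up at the origin are the lines `[v]`, `v ∈ ℂ² \ 0`.
If `w` is independent of `v`, then `(x, s) ↦ x (v + s w)` is a chart of the blow-up near `[v]`,
centred at `[v]`, in which `D` is `x = 0`. -/

/-- The `k`-th coordinate `v k + s * w k` of `v + s w`, where `s = X 1`. -/
def chartDir (v w : Fin 2 → ℂ) (k : Fin 2) : Ser :=
  MvPowerSeries.C (v k) + MvPowerSeries.C (w k) * MvPowerSeries.X 1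

/-- The composition of `f` with the chart `(x, s) ↦ x (v + s w)`. -/
def pull (v w : Fin 2 → ℂ) (f : Ser) : Ser :=
  MvPowerSeries.subst (fun k : Fin 2 => MvPowerSeries.X 0 * chartDir v w k) f

/-- The foliation which the nonzero form `A dx + B ds` defines at `(x, s) = (0, 0)` is transversal
to `x = 0`: after taking out a common factor, the coefficient of `ds` does not vanish at the
point. In particular the foliation is regular there. -/
def TransversalToDivisor (A B : Ser) : Prop :=
  ∃ g u v : O, g ≠ 0 ∧ A = (g * u : O) ∧ B = (g * v : O) ∧
    MvPowerSeries.constantCoeff (v : Ser) ≠ 0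

namespace LogForm

variable {ι : Type*} [Fintype ι]

/-- The coefficient of `dx` in the pull-back of `ω = f η` to the chart `(x, s) ↦ x (v + s w)`. -/
def pullX (η : LogForm ι) (v w : Fin 2 → ℂ) : Ser :=
  pull v w η.ωx * chartDir v w 0 + pull v w η.ωy * chartDir v w 1

/-- The coefficient of `ds` in the pull-back of `ω = f η` to the chart `(x, s) ↦ x (v + s w)`. -/
def pullS (η : LogForm ι) (v w : Fin 2 → ℂ) : Ser :=
  MvPowerSeries.X 0 * (MvPowerSeries.C (w 0) * pull v w η.ωx + MvPowerSeries.C (w 1) * pull v w η.ωy)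

/-- The point `[v]` of `D` is an escape point of `η`: it lies on the strict transform of no pole,
and the strict transform of the foliation is not transversal to `D` at `[v]`. The choice of the
chart, that is of `w`, is immaterial. -/
def IsEscapePoint (η : LogForm ι) (v : Fin 2 → ℂ) : Prop :=
  v ≠ 0 ∧ (∀ i, MvPolynomial.eval v (initForm (η.f i)) ≠ 0) ∧
    ∃ w : Fin 2 → ℂ, v 0 * w 1 - v 1 * w 0 ≠ 0 ∧
      ¬ TransversalToDivisor (η.pullX v w) (η.pullS v w)

/-- No escape points on the real trace of `D`, which is the set of the lines `[v]` with `v` real. -/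
def NoRealEscapePoints (η : LogForm ι) : Prop :=
  ∀ v : Fin 2 → ℝ, ¬ η.IsEscapePoint (fun k => (v k : ℂ))

/-! ### Escape polynomial

A matrix `E` in `GL₂(ℝ)` gives real linear coordinates `(x', y')`, with `(x, y) = E (x', y')`, and
the affine coordinate `t = y' / x'` on `D`: the value `t` corresponds to the line spanned by
`E (1, t)`, and `t = ∞`, the `y'`-axis, to the line spanned by `E (0, 1)`. -/

/-- The polynomial `t ↦ f_ν (E (1, t))`, where `f_ν` is the initial form of `f`. -/
def _root_.LogModel.conePoly (E : GL (Fin 2) ℝ) (f : O) : Polynomial ℂ :=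
  MvPolynomial.aeval
    (fun k : Fin 2 => Polynomial.C ((E k 0 : ℝ) : ℂ) + Polynomial.C ((E k 1 : ℝ) : ℂ) * Polynomial.X)
    (initForm f)

/-- The points `a₁, …, a_ℓ` of the affine part of the tangent cone of the polar set. -/
def cone (η : LogForm ι) (E : GL (Fin 2) ℝ) : Finset ℂ :=
  open Classical in
  Finset.univ.biUnion fun i => (conePoly E (η.f i)).roots.toFinset

/-- The number `ρ_a`, the sum of `λ_i ν_i` over the poles `f_i` tangent to `t = a`. The initial form
of an irreducible germ is a power of a linear form, so that the multiplicity of `t = a` in the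
tangent cone of `f_i` is `ν_i` if `f_i` is tangent to `t = a`, and `0` otherwise. -/
def rho (η : LogForm ι) (E : GL (Fin 2) ℝ) (a : ℂ) : ℂ :=
  ∑ i, η.res i * ((conePoly E (η.f i)).rootMultiplicity a : ℂ)

/-- The polynomial `P_η(t) = ∑ k, ρ_k ∏ j ≠ k, (t - a_j)`, the numerator of the escape function
`R_η(t) = ∑ k, ρ_k / (t - a_k)`. -/
def escapePoly (η : LogForm ι) (E : GL (Fin 2) ℝ) : Polynomial ℂ :=
  ∑ a ∈ η.cone E, Polynomial.C (η.rho E a) *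
    ∏ b ∈ (η.cone E).erase a, (Polynomial.X - Polynomial.C b)

/-- Coordinates as they are fixed for the study of escape points: no pole is tangent to the
`y'`-axis, and `P_η` has degree `ℓ - 2`. -/
def Adapted (η : LogForm ι) (E : GL (Fin 2) ℝ) : Prop :=
  (∀ i, MvPolynomial.eval (fun k => ((E k 1 : ℝ) : ℂ)) (initForm (η.f i)) ≠ 0) ∧
    η.escapePoly E ≠ 0 ∧ (η.escapePoly E).natDegree + 2 = (η.cone E).card

/-! ### Logarithmic modifications -/

/-- `τ = {(a'₁, λ'₁), …, (a'_s, λ'_s)}` is a set of parameters for a `1`-logarithmic modification. -/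
def IsParameterSet (η : LogForm ι) (E : GL (Fin 2) ℝ) {s : ℕ} (τ : Fin s → ℂ × ℂ) : Prop :=
  Function.Injective (fun i => (τ i).1) ∧ (∀ i, (τ i).1 ∉ η.cone E) ∧ ∀ i, (τ i).2 ≠ 0

/-- `η' = η + ∑ i, λ'_i d(f'_i) / (f'_i)`, where `f'_i` is an equation of a smooth branch with tangent
`t = a'_i`. -/
structure IsModification (η : LogForm ι) (E : GL (Fin 2) ℝ) {s : ℕ} (τ : Fin s → ℂ × ℂ)
    (η' : LogForm (ι ⊕ Fin s)) : Prop where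
  params : η.IsParameterSet E τ
  f_inl : ∀ i, η'.f (Sum.inl i) = η.f i
  res_inl : ∀ i, η'.res (Sum.inl i) = η.res i
  αx_eq : η'.αx = η.αx
  αy_eq : η'.αy = η.αy
  res_inr : ∀ i, η'.res (Sum.inr i) = (τ i).2
  smooth : ∀ i, (η'.f (Sum.inr i) : Ser).order = 1
  tangent : ∀ i, (conePoly E (η'.f (Sum.inr i))).IsRoot (τ i).1

/-- A modification `η'` with parameters `τ` is symmetric: `τ` and the set of the equations `f'_i`
are invariant by complex conjugation. -/
structure IsSymmetricModification (η : LogForm ι) (E : GL (Fin 2) ℝ) {s : ℕ} (τ : Fin s → ℂ × ℂ)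
    (η' : LogForm (ι ⊕ Fin s)) : Prop extends IsModification η E τ η' where
  params_symm : ∀ i, ∃ j, τ j = (starRingEnd ℂ (τ i).1, starRingEnd ℂ (τ i).2)
  eqs_symm : ∀ i, ∃ j, η'.f (Sum.inr j) = conj (η'.f (Sum.inr i))

/-- A modification `η'` with parameters `τ` is balanced: `λ'₁ + … + λ'_s = 0` and the degree of
`P_η'` is `ℓ + s - 2`. -/
def IsBalanced (η : LogForm ι) (E : GL (Fin 2) ℝ) {s : ℕ} (τ : Fin s → ℂ × ℂ)
    (η' : LogForm (ι ⊕ Fin s)) : Prop :=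
  ∑ i, (τ i).2 = 0 ∧ η'.escapePoly E ≠ 0 ∧
    (η'.escapePoly E).natDegree + 2 = (η.cone E).card + s

end LogForm

end LogModel

end

/-!
Main resonance says that the leading part of `f η` is annihilated by the Euler field, so that it is
`g (y dx - x dy)` for a homogeneous `g`. Where `g` does not vanish and no pole passes, the strict
transform of the foliation is transversal to `D`; in an affine coordinate, the zeros of `g` off the
tangent cone are zeros of `P_η`. Adapted coordinates exist because `1`-faithfulness means `g ≠ 0`,
and it remains to add poles to the real rational function `R_η` in such a way that no real zero is
left.

At a simple zero `t₀` put a pole of small residue `w` with the sign of `R'(t₀)`: near `t₀` the new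
function looks like `R'(t₀) (t - t₀) + w / (t - t₀)`, which does not vanish. Done at all real zeros
at once, this leaves no zero, and the residues can be rational with sum zero as soon as `R`
increases at some zero and decreases at another. To reach this situation, first add
`m / (t - a) - m / (t - b)` with `a < b` beyond all zeros and poles: for all small `m` of the right
sign but finitely many, all zeros become simple, and there is an increasing and a decreasing one
next to the pair `a, b`.
-/

noncomputable section

namespace LogModel

open Polynomial Lagrange Filter Topology

section PartialFractions

variable {R : Type*} [CommRing R]

theorem nodal_union [DecidableEq R] {S T : Finset R} (h : Disjoint S T) :
    nodal (S ∪ T) id = nodal S id * nodal T id :=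
  Finset.prod_union h

theorem eval_nodal_eq_zero_iff [IsDomain R] {S : Finset R} {t : R} :
    (nodal S id).eval t = 0 ↔ t ∈ S := by
  simp [eval_nodal, Finset.prod_eq_zero_iff, sub_eq_zero]

theorem map_nodal {R' : Type*} [CommRing R'] [DecidableEq R'] {φ : R →+* R'}
    (hφ : Function.Injective φ) (S : Finset R) :
    (nodal S id).map φ = nodal (S.image φ) id := by
  simp [nodal, Polynomial.map_prod, Finset.prod_image hφ.injOn]

theorem nodal_dvd_iff {K : Type*} [Field K] {S : Finset K} {p : K[X]} :
    nodal S id ∣ p ↔ ∀ a ∈ S, p.eval a = 0 := by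
  refine ⟨fun h a ha => ?_, fun h => Finset.prod_dvd_of_coprime ?_ fun a ha =>
    dvd_iff_isRoot.2 (h a ha)⟩
  · exact dvd_iff_isRoot.1 ((X_sub_C_dvd_nodal id ha).trans h)
  · exact fun a _ b _ hab => isCoprime_X_sub_C_of_isUnit_sub (sub_ne_zero.2 hab).isUnit

variable [DecidableEq R]

/-- The numerator of `∑ a ∈ S, c a / (X - a)` over the denominator `nodal S id`. -/
def polarNum (S : Finset R) (c : R → R) : R[X] :=
  ∑ a ∈ S, C (c a) * nodal (S.erase a) id

theorem polarNum_congr {S : Finset R} {c d : R → R} (h : ∀ a ∈ S, c a = d a) :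
    polarNum S c = polarNum S d :=
  Finset.sum_congr rfl fun a ha => by rw [h a ha]

theorem polarNum_const_mul (S : Finset R) (x : R) (c : R → R) :
    (polarNum S fun a => x * c a) = C x * polarNum S c := by
  simp only [polarNum, C_mul, mul_assoc, Finset.mul_sum]

theorem polarNum_neg (S : Finset R) (c : R → R) : (polarNum S fun a => -c a) = -polarNum S c := by
  simp only [polarNum, C_neg, neg_mul, Finset.sum_neg_distrib]

theorem polarNum_sum {ι : Type*} (s : Finset ι) (S : Finset R) (c : ι → R → R) :
    (polarNum S fun a => ∑ i ∈ s, c i a) = ∑ i ∈ s, polarNum S (c i) := by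
  simp only [polarNum, map_sum, Finset.sum_mul]
  exact Finset.sum_comm

theorem polarNum_pair {a b : R} (hab : a ≠ b) (c : R → R) :
    polarNum {a, b} c = C (c a) * (X - C b) + C (c b) * (X - C a) := by
  have ha : ({a, b} : Finset R).erase a = {b} := Finset.erase_insert (by simpa using hab)
  have hb : ({a, b} : Finset R).erase b = {a} := by
    rw [Finset.pair_comm]
    exact Finset.erase_insert (by simpa using hab.symm)
  simp [polarNum, Finset.sum_pair hab, ha, hb, nodal]

theorem polarNum_union {S T : Finset R} (h : Disjoint S T) (c : R → R) :
    polarNum (S ∪ T) c = polarNum S c * nodal T id + nodal S id * polarNum T c := by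
  rw [polarNum, Finset.sum_union h, polarNum, polarNum, Finset.sum_mul, Finset.mul_sum]
  congr 1 <;> refine Finset.sum_congr rfl fun a ha => ?_
  · rw [Finset.erase_union_distrib, Finset.erase_eq_of_notMem (Finset.disjoint_left.1 h ha),
      nodal_union (h.mono_left (Finset.erase_subset _ _)), mul_assoc]
  · rw [Finset.erase_union_distrib, Finset.erase_eq_of_notMem (Finset.disjoint_right.1 h ha),
      nodal_union (h.mono_right (Finset.erase_subset _ _)), mul_left_comm]

theorem eval_polarNum {S : Finset R} (c : R → R) {t : R} (ht : t ∈ S) :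
    (polarNum S c).eval t = c t * (nodal (S.erase t) id).eval t := by
  rw [polarNum, eval_finsetSum, Finset.sum_eq_single_of_mem t ht, eval_mul, eval_C]
  intro b _ hbt
  rw [eval_mul]
  exact mul_eq_zero_of_right _ (eval_nodal_at_node (v := id) (Finset.mem_erase.2 ⟨hbt.symm, ht⟩))

theorem natDegree_polarNum_le [Nontrivial R] (S : Finset R) (c : R → R) :
    (polarNum S c).natDegree ≤ S.card - 1 := by
  refine natDegree_sum_le_of_forall_le _ _ fun a ha => (natDegree_C_mul_le _ _).trans ?_
  rw [natDegree_nodal, Finset.card_erase_of_mem ha]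

theorem coeff_polarNum_card_sub_one [Nontrivial R] (S : Finset R) (c : R → R) :
    (polarNum S c).coeff (S.card - 1) = ∑ a ∈ S, c a := by
  rw [polarNum, finsetSum_coeff]
  refine Finset.sum_congr rfl fun a ha => ?_
  rw [coeff_C_mul, ← Finset.card_erase_of_mem ha, ← natDegree_nodal (v := id), coeff_natDegree,
    nodal_monic.leadingCoeff, mul_one]

theorem natDegree_polarNum_add_two_le [Nontrivial R] {S : Finset R} {c : R → R}
    (hc : ∑ a ∈ S, c a = 0) (h : polarNum S c ≠ 0) : (polarNum S c).natDegree + 2 ≤ S.card := by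
  have hle := natDegree_polarNum_le S c
  have hne : (polarNum S c).natDegree ≠ S.card - 1 := fun heq =>
    h (leadingCoeff_eq_zero.1 (by rw [leadingCoeff, heq, coeff_polarNum_card_sub_one, hc]))
  omega

theorem map_polarNum {R' : Type*} [CommRing R'] [DecidableEq R'] {φ : R →+* R'}
    (hφ : Function.Injective φ) {S : Finset R} {c : R → R} {d : R' → R'}
    (h : ∀ a ∈ S, d (φ a) = φ (c a)) :
    (polarNum S c).map φ = polarNum (S.image φ) d := by
  simp only [polarNum, Polynomial.map_sum, Finset.sum_image hφ.injOn]
  refine Finset.sum_congr rfl fun a ha => ?_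
  rw [Polynomial.map_mul, map_C, h a ha, ← Finset.image_erase hφ, map_nodal hφ]

/-- The numerator of `P / Q + ∑ a ∈ S, c a / (X - a)` over the denominator `Q * nodal S id`. -/
def addPolesNum (P Q : R[X]) (S : Finset R) (c : R → R) : R[X] :=
  P * nodal S id + Q * polarNum S c

theorem polarNum_union_eq_addPolesNum {S T : Finset R} (h : Disjoint S T) (c : R → R) :
    polarNum (S ∪ T) c = addPolesNum (polarNum S c) (nodal S id) T c :=
  polarNum_union h c

theorem addPolesNum_congr (P Q : R[X]) {S : Finset R} {c d : R → R} (h : ∀ a ∈ S, c a = d a) :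
    addPolesNum P Q S c = addPolesNum P Q S d := by
  rw [addPolesNum, addPolesNum, polarNum_congr h]

theorem addPolesNum_union (P Q : R[X]) {S T : Finset R} (h : Disjoint S T) (c : R → R) :
    addPolesNum P Q (S ∪ T) c = addPolesNum (addPolesNum P Q S c) (Q * nodal S id) T c := by
  simp only [addPolesNum, nodal_union h, polarNum_union h]
  ring

theorem addPolesNum_mul_mul (g P Q : R[X]) (S : Finset R) (c : R → R) :
    addPolesNum (g * P) (g * Q) S c = g * addPolesNum P Q S c := by
  simp only [addPolesNum]
  ring

theorem addPolesNum_neg_neg (P Q : R[X]) (S : Finset R) (c : R → R) :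
    (addPolesNum (-P) Q S fun a => -c a) = -addPolesNum P Q S c := by
  rw [addPolesNum, addPolesNum, polarNum_neg]
  ring

theorem addPolesNum_const_mul (P Q : R[X]) (S : Finset R) (x : R) (c : R → R) :
    (addPolesNum P Q S fun a => x * c a) = P * nodal S id + C x * (Q * polarNum S c) := by
  rw [addPolesNum, polarNum_const_mul, mul_left_comm]

theorem map_addPolesNum {R' : Type*} [CommRing R'] [DecidableEq R'] {φ : R →+* R'}
    (hφ : Function.Injective φ) (P Q : R[X]) {S : Finset R} {c : R → R} {d : R' → R'}
    (h : ∀ a ∈ S, d (φ a) = φ (c a)) :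
    (addPolesNum P Q S c).map φ = addPolesNum (P.map φ) (Q.map φ) (S.image φ) d := by
  rw [addPolesNum, Polynomial.map_add, Polynomial.map_mul, Polynomial.map_mul,
    map_polarNum hφ h, map_nodal hφ, addPolesNum]

end PartialFractions

section SmallRationals

theorem exists_rat_pos_of_eventually_nhdsGT {p : ℝ → Prop} (h : ∀ᶠ x in 𝓝[>] (0 : ℝ), p x) :
    ∃ q : ℚ, 0 < q ∧ p q := by
  obtain ⟨u, hu, hp⟩ := mem_nhdsGT_iff_exists_Ioo_subset.1 h
  obtain ⟨q, hq0, hqu⟩ := exists_rat_btwn (Set.mem_Ioi.1 hu)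
  exact ⟨q, by exact_mod_cast hq0, hp ⟨hq0, hqu⟩⟩

theorem eventually_add_mul_pos {a : ℝ} (ha : 0 < a) (b : ℝ) : ∀ᶠ x in 𝓝 (0 : ℝ), 0 < a + x * b :=
  (show Continuous fun x => a + x * b by fun_prop).continuousAt.eventually
    (lt_mem_nhds (by simpa using ha))

theorem eventually_add_mul_ne_zero {a : ℝ} (ha : a ≠ 0) (b : ℝ) :
    ∀ᶠ x in 𝓝 (0 : ℝ), a + x * b ≠ 0 :=
  (show Continuous fun x => a + x * b by fun_prop).continuousAt.eventually_ne (by simpa using ha)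

theorem eventually_nhdsGT_of_cofinite {p : ℝ → Prop} (h : ∀ᶠ x in cofinite, p x) (a : ℝ) :
    ∀ᶠ x in 𝓝[>] a, p x :=
  h.filter_mono ((nhdsWithin_mono a fun _ hx => ne_of_gt hx).trans (nhdsNE_le_cofinite a))

theorem exists_rat_sum_eq_zero_of_signs {α : Type*} {T : Finset α} {s : α → ℝ}
    (hne : ∀ t ∈ T, s t ≠ 0) (hpos : ∃ t ∈ T, 0 < s t) (hneg : ∃ t ∈ T, s t < 0) :
    ∃ w : α → ℚ, ∑ t ∈ T, w t = 0 ∧ ∀ t ∈ T, 0 < w t * s t := by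
  classical
  set U := T.filter fun t => 0 < s t with hU
  set D := T.filter fun t => ¬ 0 < s t with hD
  have hUpos : (0 : ℚ) < U.card := by
    obtain ⟨t, ht, hst⟩ := hpos
    exact_mod_cast Finset.card_pos.2 ⟨t, Finset.mem_filter.2 ⟨ht, hst⟩⟩
  have hDpos : (0 : ℚ) < D.card := by
    obtain ⟨t, ht, hst⟩ := hneg
    exact_mod_cast Finset.card_pos.2 ⟨t, Finset.mem_filter.2 ⟨ht, hst.not_gt⟩⟩
  refine ⟨fun t => if 0 < s t then D.card else -U.card, ?_, fun t ht => ?_⟩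
  · rw [Finset.sum_ite, Finset.sum_const, Finset.sum_const, ← hU, ← hD, nsmul_eq_mul, nsmul_eq_mul]
    ring
  · dsimp only
    split_ifs with h
    · exact mul_pos (by exact_mod_cast hDpos) h
    · refine mul_pos_of_neg_of_neg ?_ (lt_of_le_of_ne (not_lt.1 h) (hne t ht))
      exact_mod_cast neg_lt_zero.2 hUpos

theorem eventually_forall_abs_mul_lt {ε : ℝ} (hε : 0 < ε) {α : Type*} (S : Finset α) (w : α → ℝ) :
    ∀ᶠ x in 𝓝 (0 : ℝ), ∀ a ∈ S, |x * w a| < ε :=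
  (Finset.eventually_all S).2 fun a _ =>
    (show Continuous fun x : ℝ => |x * w a| by fun_prop).continuousAt.eventually
      (gt_mem_nhds (by simpa using hε))

/-- The rational residues `l` at the points of `S` are nonzero, smaller than `ε` and balanced. -/
structure IsSmallBalanced (ε : ℝ) (S : Finset ℝ) (l : ℝ → ℚ) : Prop where
  ne_zero : ∀ a ∈ S, l a ≠ 0
  abs_lt : ∀ a ∈ S, |(l a : ℝ)| < ε
  sum_eq_zero : ∑ a ∈ S, l a = 0

namespace IsSmallBalanced

variable {ε : ℝ} {S T : Finset ℝ} {l w : ℝ → ℚ}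

theorem neg (h : IsSmallBalanced ε S l) : IsSmallBalanced ε S fun a => -l a where
  ne_zero a ha := neg_ne_zero.2 (h.ne_zero a ha)
  abs_lt a ha := by simpa using h.abs_lt a ha
  sum_eq_zero := by rw [Finset.sum_neg_distrib, h.sum_eq_zero, neg_zero]

theorem congr (h : IsSmallBalanced ε S l) (hw : ∀ a ∈ S, w a = l a) : IsSmallBalanced ε S w where
  ne_zero a ha := hw a ha ▸ h.ne_zero a ha
  abs_lt a ha := hw a ha ▸ h.abs_lt a ha
  sum_eq_zero := (Finset.sum_congr rfl hw).trans h.sum_eq_zero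

theorem union (hS : IsSmallBalanced ε S l) (hT : IsSmallBalanced ε T l) (h : Disjoint S T) :
    IsSmallBalanced ε (S ∪ T) l where
  ne_zero a ha := (Finset.mem_union.1 ha).elim (hS.ne_zero a) (hT.ne_zero a)
  abs_lt a ha := (Finset.mem_union.1 ha).elim (hS.abs_lt a) (hT.abs_lt a)
  sum_eq_zero := by rw [Finset.sum_union h, hS.sum_eq_zero, hT.sum_eq_zero, add_zero]

theorem const_mul {q : ℚ} (hq : q ≠ 0) (hne : ∀ a ∈ S, w a ≠ 0) (hsum : ∑ a ∈ S, w a = 0)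
    (hlt : ∀ a ∈ S, |(q : ℝ) * w a| < ε) : IsSmallBalanced ε S fun a => q * w a where
  ne_zero a ha := mul_ne_zero hq (hne a ha)
  abs_lt a ha := by simpa using hlt a ha
  sum_eq_zero := by rw [← Finset.mul_sum, hsum, mul_zero]

theorem pair {a b : ℝ} (hab : a ≠ b) {q : ℚ} (hq : q ≠ 0) (hlt : |(q : ℝ)| < ε) :
    IsSmallBalanced ε {a, b} fun t => if t = a then q else -q where
  ne_zero t _ := by split_ifs <;> simpa
  abs_lt t _ := by split_ifs <;> simpa
  sum_eq_zero := by simp [Finset.sum_pair hab, hab.symm]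

end IsSmallBalanced

end SmallRationals

section RealZeros

theorem exists_pos_forall_neg_eval_le_mul {A B : ℝ[X]} (hdeg : B.degree ≤ A.degree)
    (hA : ∀ t, 0 ≤ A.eval t) (hB : ∀ t, A.eval t = 0 → 0 < B.eval t) :
    ∃ M : ℝ, 0 < M ∧ ∀ t, -B.eval t ≤ M * A.eval t := by
  obtain ⟨c₁, h₁⟩ := (isBigO_atTop_of_degree_le _ _ hdeg).bound
  obtain ⟨c₂, h₂⟩ := (isBigO_atBot_of_degree_le _ _ hdeg).bound
  obtain ⟨r₁, h₁⟩ := eventually_atTop.1 h₁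
  obtain ⟨r₂, h₂⟩ := eventually_atBot.1 h₂
  have hK : IsCompact (Set.Icc r₂ r₁ ∩ {t | B.eval t ≤ 0}) :=
    isCompact_Icc.inter_right (isClosed_le B.continuous continuous_const)
  have hpos : ∀ t, B.eval t ≤ 0 → 0 < A.eval t := fun t ht =>
    (hA t).lt_of_ne fun h => (hB t h.symm).not_ge ht
  obtain ⟨c₃, h₃⟩ := hK.bddAbove_image (f := fun t => -B.eval t / A.eval t)
    (B.continuous.neg.continuousOn.div A.continuous.continuousOn fun t ht => (hpos t ht.2).ne')
  refine ⟨|c₁| + |c₂| + |c₃| + 1, by positivity, fun t => ?_⟩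
  rcases le_or_gt (B.eval t) 0 with ht | ht
  swap
  · exact (neg_nonpos.2 ht.le).trans (mul_nonneg (by positivity) (hA t))
  suffices h : ∃ c, c ≤ |c₁| + |c₂| + |c₃| + 1 ∧ -B.eval t ≤ c * A.eval t by
    obtain ⟨c, hc, h⟩ := h
    exact h.trans (mul_le_mul_of_nonneg_right hc (hA t))
  have hn : ∀ c : ℝ, ‖B.eval t‖ ≤ c * ‖A.eval t‖ → -B.eval t ≤ c * A.eval t := fun c h => by
    rw [Real.norm_eq_abs, Real.norm_eq_abs, abs_of_nonneg (hA t)] at h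
    exact (neg_le_abs _).trans h
  have p₁ := abs_nonneg c₁
  have p₂ := abs_nonneg c₂
  have p₃ := abs_nonneg c₃
  rcases le_total r₁ t with h | h
  · exact ⟨c₁, by linarith [le_abs_self c₁], hn _ (h₁ t h)⟩
  rcases le_total t r₂ with h' | h'
  · exact ⟨c₂, by linarith [le_abs_self c₂], hn _ (h₂ t h')⟩
  · exact ⟨c₃, by linarith [le_abs_self c₃],
      (div_le_iff₀ (hpos t ht)).1 (h₃ (Set.mem_image_of_mem _ ⟨⟨h', h⟩, ht⟩))⟩

theorem eventually_forall_eval_add_mul_pos {A B : ℝ[X]} (hdeg : B.degree ≤ A.degree)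
    (hA : ∀ t, 0 ≤ A.eval t) (hB : ∀ t, A.eval t = 0 → 0 < B.eval t) :
    ∀ᶠ x in 𝓝[>] (0 : ℝ), ∀ t, 0 < A.eval t + x * B.eval t := by
  obtain ⟨M, hM, h⟩ := exists_pos_forall_neg_eval_le_mul hdeg hA hB
  filter_upwards [Ioo_mem_nhdsGT (one_div_pos.2 hM)] with x ⟨hx, hxM⟩ t
  have hxM : x * M < 1 := (lt_div_iff₀ hM).1 hxM
  rcases (hA t).eq_or_lt with h0 | hAt
  · rw [← h0, zero_add]
    exact mul_pos hx (hB t h0.symm)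
  · nlinarith [h t]

theorem exists_zero_deriv_neg {f : ℝ → ℝ} {x y : ℝ} (hxy : x < y)
    (hf : ContinuousOn f (Set.Icc x y)) (hx : 0 < f x) (hy : f y < 0)
    (hs : ∀ t ∈ Set.Ioo x y, f t = 0 → deriv f t ≠ 0) :
    ∃ t ∈ Set.Ioo x y, f t = 0 ∧ deriv f t < 0 := by
  have hK : IsCompact (Set.Icc x y ∩ f ⁻¹' Set.Ici 0) :=
    isCompact_Icc.of_isClosed_subset (hf.preimage_isClosed_of_isClosed isClosed_Icc isClosed_Ici)
      Set.inter_subset_left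
  obtain ⟨z, ⟨⟨hxz, hzy⟩, hz0 : 0 ≤ f z⟩, hmax⟩ :=
    hK.exists_isGreatest ⟨x, Set.left_mem_Icc.2 hxy.le, hx.le⟩
  have hzy' : z < y := hzy.lt_of_ne fun h => (h ▸ hz0).not_gt hy
  have hneg : ∀ᶠ t in 𝓝[>] z, f t < 0 := by
    filter_upwards [Ioc_mem_nhdsGT hzy'] with t ht
    by_contra! h
    exact (hmax ⟨⟨hxz.trans ht.1.le, ht.2⟩, h⟩).not_gt ht.1
  have hfz : f z = 0 := by
    refine le_antisymm (le_of_tendsto ?_ (hneg.mono fun _ => le_of_lt)) hz0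
    refine (hf z ⟨hxz, hzy⟩).tendsto.mono_left (nhdsWithin_le_of_mem ?_)
    filter_upwards [Ioc_mem_nhdsGT hzy'] with t ht using ⟨hxz.trans ht.1.le, ht.2⟩
  have hz : z ∈ Set.Ioo x y := ⟨hxz.lt_of_ne fun h => hx.ne' (h ▸ hfz), hzy'⟩
  have hd : HasDerivWithinAt f (deriv f z) (Set.Ioi z) z :=
    (differentiableAt_of_deriv_ne_zero (hs z hz hfz)).hasDerivAt.hasDerivWithinAt
  rw [hasDerivWithinAt_iff_tendsto_slope' Set.self_notMem_Ioi] at hd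
  refine ⟨z, hz, hfz, (le_of_tendsto hd ?_).lt_of_ne (hs z hz hfz)⟩
  filter_upwards [hneg, self_mem_nhdsWithin] with t ht hzt
  rw [slope_def_field, hfz, sub_zero]
  exact div_nonpos_of_nonpos_of_nonneg ht.le (sub_nonneg.2 (le_of_lt hzt))

theorem exists_zero_deriv_pos {f : ℝ → ℝ} {x y : ℝ} (hxy : x < y)
    (hf : ContinuousOn f (Set.Icc x y)) (hx : f x < 0) (hy : 0 < f y)
    (hs : ∀ t ∈ Set.Ioo x y, f t = 0 → deriv f t ≠ 0) :
    ∃ t ∈ Set.Ioo x y, f t = 0 ∧ 0 < deriv f t := by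
  obtain ⟨t, ht, h0, hd⟩ := exists_zero_deriv_neg (f := -f) hxy hf.neg (by simpa using hx)
    (by simpa using hy) fun t ht h0 => by simpa [deriv.neg] using hs t ht (by simpa using h0)
  exact ⟨t, ht, by simpa using h0, by simpa [deriv.neg] using hd⟩

end RealZeros

section BalancedResidues

theorem eventually_natDegree_addPolesNum {P Q : ℝ[X]} (hP : P ≠ 0)
    (hdeg : Q.natDegree ≤ P.natDegree + 2) {S : Finset ℝ} {c : ℝ → ℝ} (hc : ∑ a ∈ S, c a = 0) :
    ∀ᶠ x in 𝓝 (0 : ℝ),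
      (addPolesNum P Q S fun a => x * c a).natDegree = P.natDegree + S.card := by
  have hlc : (P * nodal S id).coeff (P.natDegree + S.card) ≠ 0 := by
    rw [← natDegree_nodal (s := S) (v := id), coeff_mul_degree_add_degree,
      nodal_monic.leadingCoeff, mul_one]
    exact leadingCoeff_ne_zero.2 hP
  filter_upwards [eventually_add_mul_ne_zero hlc
    ((Q * polarNum S c).coeff (P.natDegree + S.card))] with x hx
  rw [addPolesNum_const_mul]
  refine le_antisymm (natDegree_add_le_of_degree_le ?_ ?_) (le_natDegree_of_ne_zero ?_)
  · exact natDegree_mul_le.trans_eq (by rw [natDegree_nodal])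
  · refine (natDegree_C_mul_le _ _).trans ?_
    rcases eq_or_ne (polarNum S c) 0 with h0 | h0
    · simp [h0]
    · have := natDegree_polarNum_add_two_le hc h0
      exact natDegree_mul_le.trans (by omega)
  · rwa [coeff_add, coeff_C_mul]

theorem eventually_forall_eval_addPolesNum_roots_ne_zero {P Q : ℝ[X]} (hP : P ≠ 0)
    (hdeg : Q.natDegree ≤ P.natDegree + 2) {w : ℝ → ℝ} (hsum : ∑ t ∈ P.roots.toFinset, w t = 0)
    (hsign : ∀ t ∈ P.roots.toFinset, 0 < w t * (P.derivative.eval t * Q.eval t)) :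
    ∀ᶠ x in 𝓝[>] (0 : ℝ), ∀ t,
      (addPolesNum P Q P.roots.toFinset fun a => x * w a).eval t ≠ 0 := by
  set T := P.roots.toFinset with hT
  have hmem : ∀ t, t ∈ T ↔ P.eval t = 0 := fun t => by simp [hT, hP]
  obtain ⟨H, hH⟩ : nodal T id ∣ P := nodal_dvd_iff.2 fun t ht => (hmem t).1 ht
  set N := polarNum T w with hN
  have hcofactor : ∀ t ∈ T, P.derivative.eval t = (nodal (T.erase t) id).eval t * H.eval t := by
    intro t ht
    rw [hH, derivative_mul, eval_add, eval_mul, eval_mul,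
      show eval t (nodal T id) = 0 from eval_nodal_at_node (v := id) ht, zero_mul, add_zero]
    exact congrArg (· * _) (eval_nodal_derivative_eval_node_eq (v := id) ht)
  have hpos : ∀ t, (P ^ 2).eval t = 0 → 0 < (H * N * Q).eval t := by
    intro t ht
    have ht : t ∈ T := (hmem t).2 (by simpa using ht)
    have h := hsign t ht
    rw [hcofactor t ht] at h
    rw [eval_mul, eval_mul, hN, eval_polarNum _ ht]
    linarith
  have hdegle : (H * N * Q).degree ≤ (P ^ 2).degree := by
    rcases eq_or_ne N 0 with hN0 | hN0
    · simp [hN0]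
    have hH0 : H ≠ 0 := right_ne_zero_of_mul (hH ▸ hP)
    have hPdeg : P.natDegree = T.card + H.natDegree := by
      rw [hH, natDegree_mul nodal_ne_zero hH0, natDegree_nodal]
    have hNdeg : N.natDegree + 2 ≤ T.card := natDegree_polarNum_add_two_le hsum hN0
    have hHN := natDegree_mul_le (p := H) (q := N)
    have hHNQ := natDegree_mul_le (p := H * N) (q := Q)
    rw [degree_eq_natDegree (pow_ne_zero 2 hP), natDegree_pow]
    exact degree_le_of_natDegree_le (by omega)
  -- Multiplied by the cofactor `H`, the numerator becomes `P ^ 2` plus a small term which is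
  -- positive at the zeros of `P`.
  filter_upwards [eventually_forall_eval_add_mul_pos hdegle
    (fun t => by rw [eval_pow]; positivity) hpos] with x hx t ht
  have key : H * (addPolesNum P Q T fun a => x * w a) = P ^ 2 + C x * (H * N * Q) := by
    rw [addPolesNum_const_mul]
    linear_combination (-P) * hH
  have := congrArg (eval t) key
  rw [eval_mul, ht, mul_zero, eval_add, eval_C_mul] at this
  exact (hx t).ne this

/-- The zeros of `P` are simple and `P / Q`, whose derivative at a zero has the sign of
`P' Q`, is increasing at some of them and decreasing at others. Then small balanced residues of the
sign of `P' Q` exist at these zeros. -/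
structure HasSimpleZerosOfBothSigns (P Q : ℝ[X]) : Prop where
  simple : ∀ t, P.eval t = 0 → P.derivative.eval t * Q.eval t ≠ 0
  exists_pos : ∃ t, P.eval t = 0 ∧ 0 < P.derivative.eval t * Q.eval t
  exists_neg : ∃ t, P.eval t = 0 ∧ P.derivative.eval t * Q.eval t < 0

theorem HasSimpleZerosOfBothSigns.exists_isSmallBalanced {P Q : ℝ[X]}
    (h : HasSimpleZerosOfBothSigns P Q) (hP : P ≠ 0) (hdeg : Q.natDegree ≤ P.natDegree + 2)
    {ε : ℝ} (hε : 0 < ε) :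
    ∃ l : ℝ → ℚ, IsSmallBalanced ε P.roots.toFinset l ∧
      (addPolesNum P Q P.roots.toFinset fun a => (l a : ℝ)).natDegree
        = P.natDegree + P.roots.toFinset.card ∧
      ∀ t, (addPolesNum P Q P.roots.toFinset fun a => (l a : ℝ)).eval t ≠ 0 := by
  have hmem : ∀ t, t ∈ P.roots.toFinset ↔ P.eval t = 0 := fun t => by simp [hP]
  obtain ⟨w, hsum, hsign⟩ := exists_rat_sum_eq_zero_of_signs (T := P.roots.toFinset)
    (fun t ht => h.simple t ((hmem t).1 ht))
    (h.exists_pos.imp fun t ht => ⟨(hmem t).2 ht.1, ht.2⟩)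
    (h.exists_neg.imp fun t ht => ⟨(hmem t).2 ht.1, ht.2⟩)
  have hne : ∀ t ∈ P.roots.toFinset, w t ≠ 0 := fun t ht h0 => by simpa [h0] using hsign t ht
  have hsum' : ∑ t ∈ P.roots.toFinset, (w t : ℝ) = 0 := by exact_mod_cast hsum
  have hsmall := (eventually_forall_abs_mul_lt hε P.roots.toFinset fun t => (w t : ℝ)).and
    (eventually_natDegree_addPolesNum hP hdeg hsum')
  obtain ⟨q, hq0, ⟨hlt, hqdeg⟩, hqne⟩ := exists_rat_pos_of_eventually_nhdsGT
    ((hsmall.filter_mono nhdsWithin_le_nhds).and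
      (eventually_forall_eval_addPolesNum_roots_ne_zero hP hdeg hsum' hsign))
  refine ⟨fun t => q * w t, .const_mul hq0.ne' hne hsum hlt, ?_⟩
  simp only [Rat.cast_mul]
  exact ⟨hqdeg, hqne⟩

theorem eventually_cofinite_simple_zeros {K : Type*} [Field K] {A B : K[X]} (hAB : IsCoprime A B)
    (hW : wronskian A B ≠ 0) {G : Set K} (hG : G.Finite) :
    ∀ᶠ x in cofinite, ∀ t, (A + C x * B).eval t = 0 →
      t ∉ G ∧ B.eval t ≠ 0 ∧ (A + C x * B).derivative.eval t ≠ 0 := by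
  have hfin : ((fun r => -A.eval r / B.eval r) '' ({r | (wronskian A B).eval r = 0} ∪ G)).Finite :=
    ((finite_setOfPred_isRoot hW).union hG).image _
  filter_upwards [hfin.compl_mem_cofinite] with x hx t ht
  have htAB : A.eval t + x * B.eval t = 0 := by simpa using ht
  have hBt : B.eval t ≠ 0 := fun hBt => by
    obtain ⟨u, v, huv⟩ := hAB
    have hAt : A.eval t = 0 := by simpa [hBt] using htAB
    simpa [hAt, hBt] using congrArg (eval t) huv
  have hxt : -A.eval t / B.eval t = x := (div_eq_iff hBt).2 (by linear_combination -htAB)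
  refine ⟨fun htG => hx ⟨t, Or.inr htG, hxt⟩, hBt, fun hd => hx ⟨t, Or.inl ?_, hxt⟩⟩
  simp only [derivative_add, derivative_mul, derivative_C, zero_mul, zero_add, eval_add, eval_mul,
    eval_C] at hd
  simp only [Set.mem_ofPred_eq, wronskian, eval_sub, eval_mul]
  linear_combination B.derivative.eval t * htAB - B.eval t * hd

/-- The numerator of `P / Q + m / (X - a) - m / (X - b)` over the denominator
`Q * ((X - a) * (X - b))`. -/
def dipoleNum {R : Type*} [CommRing R] (P Q : R[X]) (a b m : R) : R[X] :=
  P * ((X - C a) * (X - C b)) + C m * (C (a - b) * Q)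

theorem addPolesNum_pair {R : Type*} [CommRing R] [DecidableEq R] (P Q : R[X]) {a b : R}
    (hab : a ≠ b) {c : R → R} (hc : c b = -c a) :
    addPolesNum P Q {a, b} c = dipoleNum P Q a b (c a) := by
  rw [addPolesNum, dipoleNum, polarNum_pair hab, hc, nodal, Finset.prod_pair hab]
  simp only [id, C_neg, C_sub]
  ring

theorem eval_dipoleNum_mul {R : Type*} [CommRing R] (P Q : R[X]) (a b m t : R) :
    (dipoleNum P Q a b m * Q).eval t =
      (P * Q).eval t * ((t - a) * (t - b)) + m * ((a - b) * Q.eval t ^ 2) := by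
  simp only [dipoleNum, eval_mul, eval_add, eval_sub, eval_X, eval_C]
  ring

theorem eventually_cofinite_dipole_simple_zeros {K : Type*} [Field K] [CharZero K] {P Q : K[X]}
    (hPQ : IsCoprime P Q) (hP : P ≠ 0) {a b : K} (hab : a ≠ b) (ha : Q.eval a ≠ 0)
    (hb : Q.eval b ≠ 0) {G : Set K} (hG : G.Finite) :
    ∀ᶠ m in cofinite, ∀ t, (dipoleNum P Q a b m).eval t = 0 →
      t ∉ G ∧ Q.eval t ≠ 0 ∧ (dipoleNum P Q a b m).derivative.eval t ≠ 0 := by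
  have hX : ∀ c, Q.eval c ≠ 0 → IsCoprime (X - C c) Q := fun c hc =>
    (irreducible_X_sub_C c).coprime_iff_not_dvd.2 fun h => hc (dvd_iff_isRoot.1 h)
  have hcop : IsCoprime (P * ((X - C a) * (X - C b))) (C (a - b) * Q) :=
    (isCoprime_mul_unit_left_right (isUnit_C.2 (sub_ne_zero.2 hab).isUnit) _ _).2
      (hPQ.mul_left ((hX a ha).mul_left (hX b hb)))
  have hXX : ((X - C a) * (X - C b)).Monic := (monic_X_sub_C a).mul (monic_X_sub_C b)
  have hW : wronskian (P * ((X - C a) * (X - C b))) (C (a - b) * Q) ≠ 0 := fun h => by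
    have hd := derivative_eq_zero.1 (hcop.wronskian_eq_zero_iff.1 h).1
    rw [natDegree_mul hP hXX.ne_zero,
      natDegree_mul (X_sub_C_ne_zero a) (X_sub_C_ne_zero b)] at hd
    simp at hd
  filter_upwards [eventually_cofinite_simple_zeros hcop hW hG] with m hm t ht
  obtain ⟨htG, htQ, htd⟩ := hm t ht
  exact ⟨htG, fun h => htQ (by rw [eval_mul, h, mul_zero]), htd⟩

theorem exists_zero_derivative_mul_pos {P Q : ℝ[X]} {x y : ℝ} (hxy : x < y)
    (hs : ∀ t, P.eval t = 0 → P.derivative.eval t ≠ 0) (hQ : ∀ t ∈ Set.Icc x y, Q.eval t ≠ 0)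
    (hx : (P * Q).eval x < 0) (hy : 0 < (P * Q).eval y) :
    ∃ t ∈ Set.Ioo x y, P.eval t = 0 ∧ 0 < P.derivative.eval t * Q.eval t := by
  have hzero : ∀ t ∈ Set.Ioo x y, (P * Q).eval t = 0 → P.eval t = 0 ∧
      deriv (fun t => (P * Q).eval t) t = P.derivative.eval t * Q.eval t := fun t ht h0 => by
    rw [eval_mul] at h0
    have hPt := (mul_eq_zero.1 h0).resolve_right (hQ t (Set.Ioo_subset_Icc_self ht))
    refine ⟨hPt, ?_⟩
    rw [Polynomial.deriv, derivative_mul, eval_add, eval_mul, eval_mul, hPt, zero_mul, add_zero]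
  obtain ⟨t, ht, h0, hd⟩ := exists_zero_deriv_pos hxy (P * Q).continuous.continuousOn hx hy
    fun t ht h0 => by
      rw [(hzero t ht h0).2]
      exact mul_ne_zero (hs t (hzero t ht h0).1) (hQ t (Set.Ioo_subset_Icc_self ht))
  exact ⟨t, ht, (hzero t ht h0).1, (hzero t ht h0).2 ▸ hd⟩

theorem exists_zero_derivative_mul_neg {P Q : ℝ[X]} {x y : ℝ} (hxy : x < y)
    (hs : ∀ t, P.eval t = 0 → P.derivative.eval t ≠ 0) (hQ : ∀ t ∈ Set.Icc x y, Q.eval t ≠ 0)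
    (hx : 0 < (P * Q).eval x) (hy : (P * Q).eval y < 0) :
    ∃ t ∈ Set.Ioo x y, P.eval t = 0 ∧ P.derivative.eval t * Q.eval t < 0 := by
  obtain ⟨t, ht, h0, hd⟩ := exists_zero_derivative_mul_pos (P := P) (Q := -Q) hxy hs
    (by simpa using hQ) (by simpa using hx) (by simpa using hy)
  exact ⟨t, ht, h0, by simpa using hd⟩

theorem eventually_dipole_signs {P Q : ℝ[X]} {x a b y : ℝ} (hxa : x < a) (hab : a < b)
    (hby : b < y) (hx : 0 < (P * Q).eval x) (ha : Q.eval a ≠ 0) (hb : Q.eval b ≠ 0)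
    (hy : 0 < (P * Q).eval y) :
    ∀ᶠ m in 𝓝[>] (0 : ℝ), 0 < (dipoleNum P Q a b m * Q).eval x ∧
      (dipoleNum P Q a b m * Q).eval a < 0 ∧ (dipoleNum P Q a b m * Q).eval b < 0 ∧
        0 < (dipoleNum P Q a b m * Q).eval y := by
  have hends : ∀ z, 0 < (P * Q).eval z → 0 < (z - a) * (z - b) →
      ∀ᶠ m in 𝓝[>] (0 : ℝ), 0 < (dipoleNum P Q a b m * Q).eval z := fun z hz h => by
    simp only [eval_dipoleNum_mul]
    exact nhdsWithin_le_nhds (eventually_add_mul_pos (mul_pos hz h) _)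
  have hnodes : ∀ z, Q.eval z ≠ 0 → (z - a) * (z - b) = 0 →
      ∀ᶠ m in 𝓝[>] (0 : ℝ), (dipoleNum P Q a b m * Q).eval z < 0 := fun z hz h => by
    filter_upwards [self_mem_nhdsWithin] with m hm
    rw [eval_dipoleNum_mul, h, mul_zero, zero_add]
    exact mul_neg_of_pos_of_neg hm
      (mul_neg_of_neg_of_pos (sub_neg.2 hab) (sq_pos_of_ne_zero hz))
  exact (hends x hx (mul_pos_of_neg_of_neg (by linarith) (by linarith))).and
    ((hnodes a ha (by simp)).and ((hnodes b hb (by simp)).and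
      (hends y hy (mul_pos (by linarith) (by linarith)))))

theorem eventually_dipole_hasSimpleZerosOfBothSigns {P Q : ℝ[X]} (hPQ : IsCoprime P Q)
    {x a b y : ℝ} (hxa : x < a) (hab : a < b) (hby : b < y)
    (hpos : ∀ t ∈ Set.Icc x y, 0 < (P * Q).eval t) :
    ∀ᶠ m in 𝓝[>] (0 : ℝ), HasSimpleZerosOfBothSigns (dipoleNum P Q a b m)
      (Q * ((X - C a) * (X - C b))) := by
  have hQ : ∀ t, x ≤ t → t ≤ y → Q.eval t ≠ 0 := fun t hxt hty h => by
    simpa [h] using hpos t ⟨hxt, hty⟩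
  have hP0 : P ≠ 0 := fun h => by simpa [h] using hpos a ⟨hxa.le, by linarith⟩
  have hQa := hQ a hxa.le (by linarith)
  have hQb := hQ b (by linarith) hby.le
  filter_upwards [eventually_dipole_signs hxa hab hby (hpos x ⟨le_rfl, by linarith⟩) hQa hQb
      (hpos y ⟨by linarith, le_rfl⟩),
    eventually_nhdsGT_of_cofinite (eventually_cofinite_dipole_simple_zeros hPQ hP0 hab.ne
      hQa hQb (Set.toFinite {a, b})) 0] with m ⟨hRx, hRa, hRb, hRy⟩ hs
  have hRs : ∀ t, (dipoleNum P Q a b m).eval t = 0 →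
      (dipoleNum P Q a b m).derivative.eval t ≠ 0 := fun t ht => (hs t ht).2.2
  have heval : ∀ t, (Q * ((X - C a) * (X - C b))).eval t = Q.eval t * ((t - a) * (t - b)) := by
    simp
  refine ⟨fun t ht => ?_, ?_, ?_⟩
  · obtain ⟨htab, htQ, htd⟩ := hs t ht
    simp only [Set.mem_insert_iff, Set.mem_singleton_iff, not_or, ← sub_ne_zero (b := a),
      ← sub_ne_zero (b := b)] at htab
    rw [heval]
    exact mul_ne_zero htd (mul_ne_zero htQ (mul_ne_zero htab.1 htab.2))
  · obtain ⟨t, ht, h0, hd⟩ := exists_zero_derivative_mul_pos hby hRs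
      (fun t ht => hQ t (by linarith [ht.1]) ht.2) hRb hRy
    refine ⟨t, h0, ?_⟩
    rw [heval, ← mul_assoc]
    exact mul_pos hd (mul_pos (by linarith [ht.1]) (by linarith [ht.1]))
  · obtain ⟨t, ht, h0, hd⟩ := exists_zero_derivative_mul_neg hxa hRs
      (fun t ht => hQ t ht.1 (by linarith [ht.2])) hRx hRa
    refine ⟨t, h0, ?_⟩
    rw [heval, ← mul_assoc]
    exact mul_neg_of_neg_of_pos hd (mul_pos_of_neg_of_neg (by linarith [ht.2]) (by linarith [ht.2]))

theorem eventually_natDegree_dipoleNum {P Q : ℝ[X]} (hP : P ≠ 0)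
    (hdeg : Q.natDegree ≤ P.natDegree + 2) {a b : ℝ} (hab : a ≠ b) :
    ∀ᶠ m in 𝓝 (0 : ℝ), (dipoleNum P Q a b m).natDegree = P.natDegree + 2 := by
  filter_upwards [eventually_natDegree_addPolesNum hP hdeg (S := {a, b})
    (c := fun t => if t = a then 1 else -1) (by simp [Finset.sum_pair hab, hab.symm])] with m hm
  rwa [addPolesNum_pair P Q hab (by simp [hab.symm]), if_pos rfl, mul_one,
    Finset.card_pair hab] at hm

theorem exists_isSmallBalanced_hasSimpleZerosOfBothSigns {P Q : ℝ[X]} (hPQ : IsCoprime P Q)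
    (hdeg : Q.natDegree ≤ P.natDegree + 2) (hpos : ∀ᶠ x in atTop, 0 < (P * Q).eval x)
    {G : Set ℝ} (hG : G.Finite) {ε : ℝ} (hε : 0 < ε) :
    ∃ (S : Finset ℝ) (l : ℝ → ℚ), S.Nonempty ∧ Disjoint (S : Set ℝ) G ∧ IsSmallBalanced ε S l ∧
      (addPolesNum P Q S fun a => (l a : ℝ)).natDegree = P.natDegree + S.card ∧
      (∀ t, (addPolesNum P Q S fun a => (l a : ℝ)).eval t = 0 → t ∉ (S : Set ℝ) ∪ G) ∧
      HasSimpleZerosOfBothSigns (addPolesNum P Q S fun a => (l a : ℝ)) (Q * nodal S id) := by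
  have hnG : ∀ᶠ x in atTop, x ∉ G :=
    hG.bddAbove.elim fun N hN => (eventually_gt_atTop N).mono fun x hx h => (hN h).not_gt hx
  obtain ⟨x, hx⟩ := eventually_atTop.1 (hpos.and hnG)
  have hP0 : P ≠ 0 := fun h => by simpa [h] using (hx x le_rfl).1
  have hQ : ∀ t, x ≤ t → Q.eval t ≠ 0 := fun t ht h => by simpa [h] using (hx t ht).1
  obtain ⟨a, b, hxa, hab⟩ : ∃ a b, x < a ∧ a < b := ⟨x + 1, x + 2, by linarith, by linarith⟩
  have hsmall := (eventually_natDegree_dipoleNum hP0 hdeg hab.ne).filter_mono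
    (nhdsWithin_le_nhds (s := Set.Ioi 0))
  have hzeros := eventually_nhdsGT_of_cofinite (eventually_cofinite_dipole_simple_zeros hPQ hP0
    hab.ne (hQ a hxa.le) (hQ b (hxa.trans hab).le) ((Set.toFinite {a, b}).union hG)) 0
  have hsigns := eventually_dipole_hasSimpleZerosOfBothSigns hPQ hxa hab (lt_add_one b)
    fun t ht => (hx t ht.1).1
  have hlt : ∀ᶠ m in 𝓝[>] (0 : ℝ), |m| < ε :=
    nhdsWithin_le_nhds ((continuous_abs.tendsto' 0 0 abs_zero).eventually_lt_const hε)
  obtain ⟨m, hm, ⟨⟨⟨hmdeg, hmzeros⟩, hmsigns⟩, hmlt⟩⟩ := exists_rat_pos_of_eventually_nhdsGT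
    (((hsmall.and hzeros).and hsigns).and hlt)
  have hdipole : (addPolesNum P Q {a, b} fun t => ((if t = a then m else -m : ℚ) : ℝ)) =
      dipoleNum P Q a b m := by
    rw [addPolesNum_pair P Q hab.ne (by simp [hab.ne']), if_pos rfl]
  refine ⟨{a, b}, fun t => if t = a then m else -m, Finset.insert_nonempty _ _, ?_,
    .pair hab.ne hm.ne' hmlt, ?_⟩
  · rw [Finset.coe_pair, Set.disjoint_left]
    rintro t (rfl | rfl)
    exacts [(hx _ hxa.le).2, (hx _ (hxa.trans hab).le).2]
  · rw [hdipole, Finset.coe_pair, Finset.card_pair hab.ne, nodal, Finset.prod_pair hab.ne]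
    exact ⟨hmdeg, fun t ht => (hmzeros t ht).1, hmsigns⟩

theorem exists_isSmallBalanced_of_isCoprime_of_pos {P Q : ℝ[X]} (hPQ : IsCoprime P Q)
    (hdeg : Q.natDegree ≤ P.natDegree + 2) (hpos : ∀ᶠ x in atTop, 0 < (P * Q).eval x)
    {G : Set ℝ} (hG : G.Finite) {ε : ℝ} (hε : 0 < ε) :
    ∃ (S : Finset ℝ) (l : ℝ → ℚ), S.Nonempty ∧ Disjoint (S : Set ℝ) G ∧ IsSmallBalanced ε S l ∧
      (addPolesNum P Q S fun a => (l a : ℝ)).natDegree = P.natDegree + S.card ∧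
      ∀ t, (addPolesNum P Q S fun a => (l a : ℝ)).eval t ≠ 0 := by
  obtain ⟨S, l, hS, hSG, hl, hldeg, hzeros, hsigns⟩ :=
    exists_isSmallBalanced_hasSimpleZerosOfBothSigns hPQ hdeg hpos hG hε
  set P₁ := addPolesNum P Q S fun a => (l a : ℝ) with hP₁
  have hP₁0 : P₁ ≠ 0 := fun h => by
    rw [h, natDegree_zero] at hldeg
    exact hS.card_ne_zero (by omega)
  have hdeg₁ : (Q * nodal S id).natDegree ≤ P₁.natDegree + 2 :=
    natDegree_mul_le.trans (by rw [natDegree_nodal]; omega)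
  obtain ⟨w, hw, hwdeg, hwne⟩ := hsigns.exists_isSmallBalanced hP₁0 hdeg₁ hε
  set T := P₁.roots.toFinset with hT
  have hmemT : ∀ t ∈ T, t ∉ (S : Set ℝ) ∪ G := fun t ht => hzeros t (by simpa [hT, hP₁0] using ht)
  have hST : Disjoint S T := Finset.disjoint_right.2 fun t ht h => hmemT t ht (Or.inl h)
  have hlS : ∀ a ∈ S, S.piecewise l w a = l a := fun a ha => S.piecewise_eq_of_mem l w ha
  have hwT : ∀ a ∈ T, S.piecewise l w a = w a := fun a ha =>
    S.piecewise_eq_of_notMem l w (Finset.disjoint_right.1 hST ha)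
  have key : (addPolesNum P Q (S ∪ T) fun a => ((S.piecewise l w a : ℚ) : ℝ)) =
      addPolesNum P₁ (Q * nodal S id) T fun a => (w a : ℝ) := by
    rw [addPolesNum_union P Q hST, addPolesNum_congr _ _ fun a ha => by rw [hwT a ha], hP₁,
      addPolesNum_congr P Q fun a ha => by rw [hlS a ha]]
  refine ⟨S ∪ T, S.piecewise l w, hS.mono Finset.subset_union_left, ?_,
    (hl.congr hlS).union (hw.congr hwT) hST, ?_, key ▸ hwne⟩
  · rw [Finset.coe_union, Set.disjoint_union_left]
    exact ⟨hSG, Set.disjoint_left.2 fun t ht h => hmemT t ht (Or.inr h)⟩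
  · rw [key, hwdeg, hldeg, Finset.card_union_of_disjoint hST, add_assoc]

theorem eventually_atTop_eval_pos {P : ℝ[X]} (hP : 0 < P.leadingCoeff) :
    ∀ᶠ x in atTop, 0 < P.eval x := by
  by_cases hdeg : 0 < P.degree
  · exact (P.tendsto_atTop_of_leadingCoeff_nonneg hdeg hP.le).eventually_gt_atTop 0
  · rw [eq_C_of_degree_le_zero (not_lt.1 hdeg), leadingCoeff_C] at hP
    rw [eq_C_of_degree_le_zero (not_lt.1 hdeg)]
    exact .of_forall fun _ => by simpa using hP

theorem eventually_atTop_eval_pos_or_neg {P : ℝ[X]} (hP : P ≠ 0) :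
    (∀ᶠ x in atTop, 0 < P.eval x) ∨ ∀ᶠ x in atTop, P.eval x < 0 := by
  rcases (leadingCoeff_ne_zero.2 hP).lt_or_gt with hneg | hpos
  · exact .inr ((eventually_atTop_eval_pos (P := -P) (by simpa)).mono fun x hx => by simpa using hx)
  · exact .inl (eventually_atTop_eval_pos hpos)

theorem exists_isSmallBalanced_of_isCoprime {P Q : ℝ[X]} (hPQ : IsCoprime P Q) (hP : P ≠ 0)
    (hQ : Q ≠ 0) (hdeg : Q.natDegree ≤ P.natDegree + 2) {G : Set ℝ} (hG : G.Finite) {ε : ℝ}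
    (hε : 0 < ε) :
    ∃ (S : Finset ℝ) (l : ℝ → ℚ), S.Nonempty ∧ Disjoint (S : Set ℝ) G ∧ IsSmallBalanced ε S l ∧
      (addPolesNum P Q S fun a => (l a : ℝ)).natDegree = P.natDegree + S.card ∧
      ∀ t, (addPolesNum P Q S fun a => (l a : ℝ)).eval t ≠ 0 := by
  rcases eventually_atTop_eval_pos_or_neg (mul_ne_zero hP hQ) with hpos | hneg
  · exact exists_isSmallBalanced_of_isCoprime_of_pos hPQ hdeg hpos hG hε
  obtain ⟨S, l, hS, hSG, hl, hldeg, hlne⟩ := exists_isSmallBalanced_of_isCoprime_of_pos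
    hPQ.neg_left (by rwa [natDegree_neg]) (hneg.mono fun x hx => by simpa using hx) hG hε
  have key : (addPolesNum P Q S fun a => ((-l a : ℚ) : ℝ)) =
      -addPolesNum (-P) Q S fun a => (l a : ℝ) := by
    rw [← addPolesNum_neg_neg, neg_neg]
    simp only [Rat.cast_neg]
  refine ⟨S, fun a => -l a, hS, hSG, hl.neg, ?_, fun t => ?_⟩
  · rw [key, natDegree_neg, hldeg, natDegree_neg]
  · rw [key, eval_neg]
    exact neg_ne_zero.2 (hlne t)

theorem exists_isCoprime_mul_eq {K : Type*} [Field K] (P Q : K[X]) :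
    ∃ g P₀ Q₀ : K[X], IsCoprime P₀ Q₀ ∧ P = g * P₀ ∧ Q = g * Q₀ := by
  classical
  let := EuclideanDomain.gcdMonoid K[X]
  obtain ⟨P₀, Q₀, hP, hQ, hunit⟩ := extract_gcd P Q
  exact ⟨_, P₀, Q₀, (gcd_isUnit_iff P₀ Q₀).1 hunit, hP, hQ⟩

theorem exists_isSmallBalanced_forall_eval_ne_zero {P Q : ℝ[X]} (hP : P ≠ 0) (hQ : Q ≠ 0)
    (hdeg : Q.natDegree ≤ P.natDegree + 2) {G : Set ℝ} (hG : G.Finite) {ε : ℝ} (hε : 0 < ε) :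
    ∃ (S : Finset ℝ) (l : ℝ → ℚ), S.Nonempty ∧ Disjoint (S : Set ℝ) G ∧ IsSmallBalanced ε S l ∧
      (addPolesNum P Q S fun a => (l a : ℝ)).natDegree = P.natDegree + S.card ∧
      ∀ t, Q.eval t ≠ 0 → (addPolesNum P Q S fun a => (l a : ℝ)).eval t ≠ 0 := by
  obtain ⟨g, P₀, Q₀, hcop, rfl, rfl⟩ := exists_isCoprime_mul_eq P Q
  obtain ⟨hg, hP₀⟩ := mul_ne_zero_iff.1 hP
  have hQ₀ := right_ne_zero_of_mul hQ
  rw [natDegree_mul hg hQ₀, natDegree_mul hg hP₀, add_assoc, add_le_add_iff_left] at hdeg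
  obtain ⟨S, l, hS, hSG, hl, hldeg, hlne⟩ := exists_isSmallBalanced_of_isCoprime hcop hP₀ hQ₀ hdeg
    hG hε
  have hne : (addPolesNum P₀ Q₀ S fun a => (l a : ℝ)) ≠ 0 := fun h => hlne 0 (by simp [h])
  refine ⟨S, l, hS, hSG, hl, ?_, fun t ht => ?_⟩
  · rw [addPolesNum_mul_mul, natDegree_mul hg hne, natDegree_mul hg hP₀, hldeg, add_assoc]
  · rw [addPolesNum_mul_mul, eval_mul]
    exact mul_ne_zero (fun h => ht (by rw [eval_mul, h, zero_mul])) (hlne t)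

end BalancedResidues

section LeadForm

theorem degree_fin_two (d : Fin 2 →₀ ℕ) : d.degree = d 0 + d 1 := by
  rw [Finsupp.degree_eq_sum, Fin.sum_univ_two]

theorem single_add_single_fin_two (d : Fin 2 →₀ ℕ) :
    Finsupp.single 0 (d 0) + Finsupp.single 1 (d 1) = d := by
  ext k
  fin_cases k <;> simp

/-- The homogeneous component of degree `n` of a power series, as a polynomial. -/
def homPart (n : ℕ) (f : Ser) : MvPolynomial (Fin 2) ℂ :=
  ∑ p ∈ Finset.HasAntidiagonal.antidiagonal n,
    MvPolynomial.monomial (Finsupp.single 0 p.1 + Finsupp.single 1 p.2)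
      (MvPowerSeries.coeff (Finsupp.single 0 p.1 + Finsupp.single 1 p.2) f)

theorem coeff_homPart (n : ℕ) (f : Ser) (d : Fin 2 →₀ ℕ) :
    MvPolynomial.coeff d (homPart n f) = if d.degree = n then MvPowerSeries.coeff d f else 0 := by
  rw [homPart, MvPolynomial.coeff_sum, degree_fin_two]
  simp only [MvPolynomial.coeff_monomial]
  split_ifs with h
  · rw [Finset.sum_eq_single (d 0, d 1)]
    · rw [if_pos (single_add_single_fin_two d), single_add_single_fin_two]
    · rintro ⟨i, j⟩ _ hne
      refine if_neg fun hd => hne ?_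
      rw [← hd]
      simp
    · exact fun hn => absurd (Finset.HasAntidiagonal.mem_antidiagonal.2 h) hn
  · refine Finset.sum_eq_zero fun p hp => if_neg fun hd => h ?_
    rw [← hd, ← Finset.HasAntidiagonal.mem_antidiagonal.1 hp]
    simp

theorem coe_homPart (n : ℕ) (f : Ser) :
    (homPart n f : Ser) = MvPowerSeries.homogeneousComponent n f := by
  ext d
  rw [MvPolynomial.coeff_coe, coeff_homPart, MvPowerSeries.coeff_homogeneousComponent]

theorem homPart_isHomogeneous (n : ℕ) (f : Ser) : (homPart n f).IsHomogeneous n := by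
  refine MvPolynomial.IsHomogeneous.sum _ _ _ fun p hp => ?_
  apply MvPolynomial.isHomogeneous_monomial
  rw [degree_fin_two, ← Finset.HasAntidiagonal.mem_antidiagonal.1 hp]
  simp

theorem homPart_eq_zero {f : Ser} {n : ℕ} (h : n < f.order) : homPart n f = 0 := by
  apply MvPolynomial.coe_injective
  rw [coe_homPart, MvPowerSeries.homogeneousComponent_of_lt_order_eq_zero h, MvPolynomial.coe_zero]

theorem homPart_ne_zero {f : Ser} {n : ℕ} (h : n = f.order) : homPart n f ≠ 0 := fun h0 => by
  have := MvPowerSeries.homogeneousComponent_of_order h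
  rw [← coe_homPart, h0, MvPolynomial.coe_zero] at this
  exact this rfl

theorem homPart_pderiv (n : ℕ) (k : Fin 2) (f : Ser) :
    homPart n (MvPowerSeries.pderiv ℂ k f) = MvPolynomial.pderiv k (homPart (n + 1) f) := by
  ext d
  rw [coeff_homPart, ← MvPolynomial.coeff_coe (MvPolynomial.pderiv k (homPart (n + 1) f)),
    ← MvPowerSeries.pderiv_coe,
    MvPowerSeries.coeff_pderiv, MvPowerSeries.coeff_pderiv, MvPolynomial.coeff_coe, coeff_homPart]
  simp only [map_add, Finsupp.degree_single, Nat.add_right_cancel_iff]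
  split_ifs <;> simp

theorem le_order_pderiv {n : ℕ} {f : Ser} (k : Fin 2) (h : ((n + 1 : ℕ) : ℕ∞) ≤ f.order) :
    (n : ℕ∞) ≤ (MvPowerSeries.pderiv ℂ k f).order := by
  refine MvPowerSeries.nat_le_order fun d hd => ?_
  rw [MvPowerSeries.coeff_pderiv, MvPowerSeries.coeff_of_lt_order, zero_mul]
  refine lt_of_lt_of_le ?_ h
  rw [map_add, Finsupp.degree_single]
  exact_mod_cast Nat.succ_lt_succ hd

theorem order_eq_ord {f : O} (hf : f ≠ 0) : (f : Ser).order = ord f :=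
  (MvPowerSeries.ne_zero_iff_order_finite.1 fun h => hf (Subtype.ext h)).symm

/-- `f` has order at least `n`, and `p` is its homogeneous component of degree `n`. Since `p = 0` is
allowed, such leading forms can be added. -/
structure HasLeadForm (n : ℕ) (f : Ser) (p : MvPolynomial (Fin 2) ℂ) : Prop where
  le_order : (n : ℕ∞) ≤ f.order
  homPart_eq : homPart n f = p

theorem hasLeadForm_initForm {f : O} (hf : f ≠ 0) : HasLeadForm (ord f) f (initForm f) :=
  ⟨(order_eq_ord hf).ge, rfl⟩

theorem hasLeadForm_zero_of_lt_order {f : Ser} {n : ℕ} (h : n < f.order) : HasLeadForm n f 0 :=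
  ⟨h.le, homPart_eq_zero h⟩

theorem hasLeadForm_coe_of_isHomogeneous {n : ℕ} {p : MvPolynomial (Fin 2) ℂ}
    (hp : p.IsHomogeneous n) : HasLeadForm n p p := by
  have hcoeff : ∀ d : Fin 2 →₀ ℕ, d.degree ≠ n → p.coeff d = 0 := fun d hd =>
    hp.coeff_eq_zero hd
  refine ⟨MvPowerSeries.nat_le_order fun d hd => ?_, ?_⟩
  · rw [MvPolynomial.coeff_coe, hcoeff d (by exact_mod_cast hd.ne)]
  · ext d
    rw [coeff_homPart, MvPolynomial.coeff_coe]
    split_ifs with h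
    exacts [rfl, (hcoeff d h).symm]

namespace HasLeadForm

variable {n m : ℕ} {f g : Ser} {p q : MvPolynomial (Fin 2) ℂ}

theorem isHomogeneous (h : HasLeadForm n f p) : p.IsHomogeneous n :=
  h.homPart_eq ▸ homPart_isHomogeneous n f

theorem ne_zero_of_order_eq (h : HasLeadForm n f p) (hn : n = f.order) : p ≠ 0 :=
  h.homPart_eq ▸ homPart_ne_zero hn

theorem succ_le_order (h : HasLeadForm n f 0) : ((n + 1 : ℕ) : ℕ∞) ≤ f.order := by
  rw [Nat.cast_add, Nat.cast_one]
  exact Order.add_one_le_of_lt (h.le_order.lt_of_ne fun hn => h.ne_zero_of_order_eq hn rfl)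

theorem mul (hf : HasLeadForm n f p) (hg : HasLeadForm m g q) :
    HasLeadForm (n + m) (f * g) (p * q) := by
  refine ⟨by rw [MvPowerSeries.order_mul, Nat.cast_add]; exact add_le_add hf.le_order hg.le_order,
    MvPolynomial.coe_injective _ _ ?_⟩
  rw [MvPolynomial.coe_mul, coe_homPart, ← hf.homPart_eq, ← hg.homPart_eq, coe_homPart, coe_homPart,
    MvPowerSeries.homogeneousComponent_mul_of_le_order hf.le_order hg.le_order]

theorem add (hf : HasLeadForm n f p) (hg : HasLeadForm n g q) : HasLeadForm n (f + g) (p + q) := by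
  refine ⟨(le_min hf.le_order hg.le_order).trans MvPowerSeries.min_order_le_add,
    MvPolynomial.coe_injective _ _ ?_⟩
  rw [MvPolynomial.coe_add, coe_homPart, ← hf.homPart_eq, ← hg.homPart_eq, coe_homPart, coe_homPart,
    map_add]

theorem pderiv (hf : HasLeadForm (n + 1) f p) (k : Fin 2) :
    HasLeadForm n (MvPowerSeries.pderiv ℂ k f) (MvPolynomial.pderiv k p) :=
  ⟨le_order_pderiv k hf.le_order, by rw [homPart_pderiv, hf.homPart_eq]⟩

theorem smul (c : ℂ) (hf : HasLeadForm n f p) : HasLeadForm n (c • f) (c • p) := by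
  have h := (hasLeadForm_coe_of_isHomogeneous (MvPolynomial.isHomogeneous_C (Fin 2) c)).mul hf
  rwa [zero_add, MvPolynomial.coe_C, ← MvPowerSeries.smul_eq_C_mul, ← MvPolynomial.smul_eq_C_mul]
    at h

theorem sum {κ : Type*} {s : Finset κ} {f : κ → Ser} {p : κ → MvPolynomial (Fin 2) ℂ}
    (h : ∀ i ∈ s, HasLeadForm n (f i) (p i)) : HasLeadForm n (∑ i ∈ s, f i) (∑ i ∈ s, p i) := by
  classical
  induction s using Finset.induction_on with
  | empty => exact hasLeadForm_zero_of_lt_order (by simp)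
  | insert a s ha ih =>
    rw [Finset.sum_insert ha, Finset.sum_insert ha]
    exact (h a (Finset.mem_insert_self a s)).add
      (ih fun i hi => h i (Finset.mem_insert_of_mem hi))

theorem prod {κ : Type*} {s : Finset κ} {n : κ → ℕ} {f : κ → Ser}
    {p : κ → MvPolynomial (Fin 2) ℂ} (h : ∀ i ∈ s, HasLeadForm (n i) (f i) (p i)) :
    HasLeadForm (∑ i ∈ s, n i) (∏ i ∈ s, f i) (∏ i ∈ s, p i) := by
  classical
  induction s using Finset.induction_on with
  | empty => simpa using hasLeadForm_coe_of_isHomogeneous (MvPolynomial.isHomogeneous_one (Fin 2) ℂ)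
  | insert a s ha ih =>
    rw [Finset.sum_insert ha, Finset.prod_insert ha, Finset.prod_insert ha]
    exact (h a (Finset.mem_insert_self a s)).mul
      (ih fun i hi => h i (Finset.mem_insert_of_mem hi))

end HasLeadForm

theorem hasLeadForm_X (k : Fin 2) : HasLeadForm 1 (MvPowerSeries.X k) (MvPolynomial.X k) := by
  rw [← MvPolynomial.coe_X]
  exact hasLeadForm_coe_of_isHomogeneous (MvPolynomial.isHomogeneous_X ℂ k)

end LeadForm

section Convergence

theorem Converges.exists_norm_coeff_le {f : Ser} (hf : Converges f) :
    ∃ C R : ℝ, 0 ≤ C ∧ 1 ≤ R ∧ ∀ d, ‖MvPowerSeries.coeff d f‖ ≤ C * R ^ d.degree := by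
  simpa only [degree_fin_two] using hf.good

theorem converges_of_norm_coeff_le {f : Ser} {C R : ℝ}
    (h : ∀ d, ‖MvPowerSeries.coeff d f‖ ≤ C * R ^ d.degree) : Converges f :=
  ⟨C, R, by simpa only [degree_fin_two] using h⟩

theorem Converges.smul {f : Ser} (c : ℂ) (hf : Converges f) : Converges (c • f) := by
  rw [MvPowerSeries.smul_eq_C_mul]
  exact (converges_C c).mul hf

theorem Converges.pderiv {f : Ser} (k : Fin 2) (hf : Converges f) :
    Converges (MvPowerSeries.pderiv ℂ k f) := by
  obtain ⟨C, R, hC, hR, h⟩ := hf.exists_norm_coeff_le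
  refine converges_of_norm_coeff_le (C := C * R) (R := 2 * R) fun d => ?_
  have hexp : ‖(d k : ℂ) + 1‖ ≤ 2 ^ d.degree := by
    rw [← Nat.cast_add_one, Complex.norm_natCast]
    exact_mod_cast ((Finsupp.le_degree k d).trans_lt Nat.lt_two_pow_self).nat_succ_le
  rw [MvPowerSeries.coeff_pderiv, norm_mul]
  calc ‖MvPowerSeries.coeff (d + Finsupp.single k 1) f‖ * ‖(d k : ℂ) + 1‖
      ≤ C * R ^ (d + Finsupp.single k 1).degree * 2 ^ d.degree :=
        mul_le_mul (h _) hexp (norm_nonneg _) (by positivity)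
    _ = C * R * (2 * R) ^ d.degree := by
        rw [map_add, Finsupp.degree_single, mul_pow, pow_succ]
        ring

theorem sum_range_quarter_le (n : ℕ) : ∑ i ∈ Finset.range n, (1 / 4 : ℝ) ^ i ≤ 2 := by
  rw [geom_sum_eq (by norm_num), div_le_iff_of_neg (by norm_num)]
  linarith [pow_nonneg (by norm_num : (0 : ℝ) ≤ 1 / 4) n]

theorem sum_antidiagonal_quarter_le (n : Fin 2 →₀ ℕ) :
    ∑ x ∈ Finset.HasAntidiagonal.antidiagonal n, (1 / 4 : ℝ) ^ x.1.degree ≤ 4 := by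
  let e : (Fin 2 →₀ ℕ) ≃ ℕ × ℕ := Finsupp.equivFunOnFinite.trans (finTwoArrowEquiv ℕ)
  have hinj : Set.InjOn (fun x : (Fin 2 →₀ ℕ) × (Fin 2 →₀ ℕ) => e x.1)
      (Finset.HasAntidiagonal.antidiagonal n : Finset _) := fun p hp q hq hpq => by
    have hfst : p.1 = q.1 := e.injective hpq
    refine Prod.ext hfst (add_left_cancel (a := p.1) ?_)
    rw [Finset.HasAntidiagonal.mem_antidiagonal.1 hp, hfst,
      Finset.HasAntidiagonal.mem_antidiagonal.1 hq]
  have hsub : (Finset.HasAntidiagonal.antidiagonal n).image (fun x => e x.1) ⊆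
      Finset.range (n 0 + 1) ×ˢ Finset.range (n 1 + 1) := fun y hy => by
    obtain ⟨x, hx, rfl⟩ := Finset.mem_image.1 hy
    have hle : x.1 ≤ n := Finset.HasAntidiagonal.mem_antidiagonal.1 hx ▸ le_self_add
    simp only [Finset.mem_product, Finset.mem_range, Nat.lt_succ_iff]
    exact ⟨hle 0, hle 1⟩
  calc ∑ x ∈ Finset.HasAntidiagonal.antidiagonal n, (1 / 4 : ℝ) ^ x.1.degree
      = ∑ y ∈ (Finset.HasAntidiagonal.antidiagonal n).image fun x => e x.1,
          (1 / 4 : ℝ) ^ (y.1 + y.2) := by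
        simp only [Finset.sum_image hinj, degree_fin_two]
        rfl
    _ ≤ ∑ y ∈ Finset.range (n 0 + 1) ×ˢ Finset.range (n 1 + 1), (1 / 4 : ℝ) ^ (y.1 + y.2) :=
        Finset.sum_le_sum_of_subset_of_nonneg hsub fun _ _ _ => by positivity
    _ = (∑ i ∈ Finset.range (n 0 + 1), (1 / 4 : ℝ) ^ i) *
          ∑ j ∈ Finset.range (n 1 + 1), (1 / 4 : ℝ) ^ j := by
        simp only [Finset.sum_mul_sum, Finset.sum_product, pow_add]
    _ ≤ 2 * 2 := mul_le_mul (sum_range_quarter_le _) (sum_range_quarter_le _)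
        (Finset.sum_nonneg fun _ _ => by positivity) (by norm_num)
    _ = 4 := by norm_num

theorem pow_le_quarter_pow_mul_pow {R S : ℝ} (hR : 0 ≤ R) (hS : 0 < S) (hRS : 4 * R ≤ S) {i : ℕ}
    (hi : i ≠ 0) : R ^ i ≤ 4 * R / S * ((1 / 4) ^ i * S ^ i) := by
  obtain ⟨k, rfl⟩ := Nat.exists_eq_succ_of_ne_zero hi
  calc R ^ (k + 1) = R * R ^ k := pow_succ' R k
    _ ≤ R * (1 / 4 * S) ^ k := by
        gcongr
        linarith
    _ = 4 * R / S * ((1 / 4) ^ (k + 1) * S ^ (k + 1)) := by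
        rw [mul_pow]
        field_simp
        ring

theorem norm_sum_antidiagonal_le {a b : (Fin 2 →₀ ℕ) → ℂ} {C R U S : ℝ} (hC : 0 ≤ C) (hR : 0 ≤ R)
    (hU : 0 ≤ U) (hS : 0 < S) (hRS : 4 * R ≤ S) (ha : ∀ d, ‖a d‖ ≤ C * R ^ d.degree)
    {n : Fin 2 →₀ ℕ} (hb : ∀ d < n, ‖b d‖ ≤ U * S ^ d.degree) :
    ‖∑ x ∈ Finset.HasAntidiagonal.antidiagonal n, if x.2 < n then a x.1 * b x.2 else 0‖ ≤
      16 * C * U * R / S * S ^ n.degree := by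
  have hterm : ∀ x ∈ Finset.HasAntidiagonal.antidiagonal n,
      ‖if x.2 < n then a x.1 * b x.2 else 0‖ ≤
        4 * C * U * R / S * S ^ n.degree * (1 / 4) ^ x.1.degree := fun x hx => by
    obtain rfl := Finset.HasAntidiagonal.mem_antidiagonal.1 hx
    split_ifs with hlt
    · have hne : x.1.degree ≠ 0 := fun h0 => by
        simp [(Finsupp.degree_eq_zero_iff x.1).1 h0] at hlt
      rw [norm_mul]
      calc ‖a x.1‖ * ‖b x.2‖ ≤ C * R ^ x.1.degree * (U * S ^ x.2.degree) :=
            mul_le_mul (ha _) (hb _ hlt) (norm_nonneg _) (by positivity)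
        _ ≤ C * (4 * R / S * ((1 / 4) ^ x.1.degree * S ^ x.1.degree)) *
              (U * S ^ x.2.degree) := by
            gcongr
            exact pow_le_quarter_pow_mul_pow hR hS hRS hne
        _ = _ := by
            rw [map_add, pow_add]
            ring
    · rw [norm_zero]
      positivity
  refine (norm_sum_le_of_le _ hterm).trans ?_
  rw [← Finset.mul_sum]
  calc _ ≤ 4 * C * U * R / S * S ^ n.degree * 4 :=
        mul_le_mul_of_nonneg_left (sum_antidiagonal_quarter_le n) (by positivity)
    _ = _ := by ring

theorem Converges.invOfUnit {f : Ser} (hf : Converges f) (u : ℂˣ) :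
    Converges (MvPowerSeries.invOfUnit f u) := by
  obtain ⟨C, R, hC, hR, h⟩ := hf.exists_norm_coeff_le
  set U := ‖((u⁻¹ : ℂˣ) : ℂ)‖ with hU
  have hU0 : 0 ≤ U := norm_nonneg _
  -- large enough for the recursion for the coefficients of `f⁻¹` to reproduce the bound `U * S ^ n`
  obtain ⟨S, hS⟩ : ∃ S : ℝ, S = 4 * R * (4 * C * U + 1) := ⟨_, rfl⟩
  have hRS : 4 * R ≤ S := hS ▸ le_mul_of_one_le_right (by positivity) (by nlinarith)
  have hS0 : 0 < S := by linarith
  have hS1 : 16 * C * U * R / S ≤ 1 := (div_le_one hS0).2 (by rw [hS]; nlinarith)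
  refine converges_of_norm_coeff_le (C := U) (R := S) fun n => ?_
  induction n using WellFoundedLT.induction with
  | ind n ih =>
    classical
    rw [MvPowerSeries.coeff_invOfUnit]
    split_ifs with h0
    · simp [h0, hU]
    rw [norm_mul, norm_neg, ← hU]
    refine mul_le_mul_of_nonneg_left ?_ hU0
    calc _ ≤ 16 * C * U * R / S * S ^ n.degree :=
          norm_sum_antidiagonal_le hC (by positivity) hU0 hS0 hRS h ih
      _ ≤ S ^ n.degree := mul_le_of_le_one_left (by positivity) hS1

theorem isUnit_iff_constantCoeff_ne_zero (f : O) :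
    IsUnit f ↔ MvPowerSeries.constantCoeff (f : Ser) ≠ 0 := by
  refine ⟨fun h => ((h.map O.subtype).map MvPowerSeries.constantCoeff).ne_zero, fun h => ?_⟩
  have hmul := MvPowerSeries.mul_invOfUnit (f : Ser) (Units.mk0 _ h) rfl
  exact IsUnit.of_mul_eq_one ⟨_, f.2.invOfUnit (Units.mk0 _ h)⟩ (Subtype.ext hmul)

theorem one_le_ord_of_irreducible {f : O} (hf : Irreducible f) : 1 ≤ ord f := by
  have h0 : MvPowerSeries.constantCoeff (f : Ser) = 0 :=
    not_not.1 fun h => hf.not_isUnit ((isUnit_iff_constantCoeff_ne_zero f).2 h)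
  have h1 := MvPowerSeries.one_le_order_iff_constCoeff_eq_zero.2 h0
  rw [order_eq_ord hf.ne_zero] at h1
  exact_mod_cast h1

theorem irreducible_of_order_eq_one {f : O} (hf : (f : Ser).order = 1) : Irreducible f := by
  have h0 : MvPowerSeries.constantCoeff (f : Ser) = 0 :=
    MvPowerSeries.one_le_order_iff_constCoeff_eq_zero.1 hf.ge
  refine ⟨fun h => (isUnit_iff_constantCoeff_ne_zero f).1 h h0, fun {a b} hab => ?_⟩
  by_contra! hn
  simp only [isUnit_iff_constantCoeff_ne_zero, not_not] at hn
  have ha := MvPowerSeries.one_le_order_iff_constCoeff_eq_zero.2 hn.1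
  have hb := MvPowerSeries.one_le_order_iff_constCoeff_eq_zero.2 hn.2
  have hmul : (f : Ser) = a * b := congrArg Subtype.val hab
  rw [hmul, MvPowerSeries.order_mul] at hf
  exact absurd ((add_le_add ha hb).trans hf.le) (by decide)

end Convergence

section PullBack

/-- The polynomial `t ↦ p (v + t w)`, the restriction of `p` to an affine line. -/
def lineEval (v w : Fin 2 → ℂ) : MvPolynomial (Fin 2) ℂ →ₐ[ℂ] ℂ[X] :=
  MvPolynomial.aeval fun k => C (v k) + C (w k) * X

theorem lineEval_X (v w : Fin 2 → ℂ) (k : Fin 2) :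
    lineEval v w (MvPolynomial.X k) = C (v k) + C (w k) * X :=
  MvPolynomial.aeval_X _ k

theorem lineEval_C (v w : Fin 2 → ℂ) (c : ℂ) : lineEval v w (MvPolynomial.C c) = C c :=
  MvPolynomial.aeval_C _ c

theorem lineEval_monomial (v w : Fin 2 → ℂ) (d : Fin 2 →₀ ℕ) (c : ℂ) :
    lineEval v w (MvPolynomial.monomial d c) =
      C c * ((C (v 0) + C (w 0) * X) ^ d 0 * (C (v 1) + C (w 1) * X) ^ d 1) := by
  rw [lineEval, MvPolynomial.aeval_monomial, Finsupp.prod_fintype _ _ (by simp),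
    Fin.prod_univ_two, algebraMap_eq]

theorem lineEval_eq_sum (v w : Fin 2 → ℂ) (p : MvPolynomial (Fin 2) ℂ) :
    lineEval v w p = ∑ d ∈ p.support, C (p.coeff d) *
      ((C (v 0) + C (w 0) * X) ^ d 0 * (C (v 1) + C (w 1) * X) ^ d 1) := by
  conv_lhs => rw [p.as_sum, map_sum]
  simp only [lineEval_monomial]

theorem eval_lineEval (v w : Fin 2 → ℂ) (t : ℂ) (p : MvPolynomial (Fin 2) ℂ) :
    (lineEval v w p).eval t = MvPolynomial.eval (v + t • w) p := by
  simp [lineEval_eq_sum, eval_finsetSum, MvPolynomial.eval_eq', mul_comm t]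

theorem coeff_X_pow_mul_aeval (n : ℕ) (q : ℂ[X]) (e : Fin 2 →₀ ℕ) :
    MvPowerSeries.coeff e ((MvPowerSeries.X 0 : Ser) ^ n * aeval (MvPowerSeries.X 1 : Ser) q) =
      if e 0 = n then q.coeff (e 1) else 0 := by
  induction q using Polynomial.induction_on' with
  | add p q hp hq =>
    rw [map_add, mul_add, map_add, hp, hq, coeff_add]
    split_ifs <;> simp
  | monomial m a =>
    have hiff : e = Finsupp.single 0 n + Finsupp.single 1 m ↔ e 0 = n ∧ m = e 1 :=
      ⟨fun h => by simp [h], fun ⟨h0, h1⟩ => by rw [← h0, h1, single_add_single_fin_two]⟩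
    rw [aeval_monomial, MvPowerSeries.algebraMap_apply, Algebra.algebraMap_self,
      RingHom.id_apply, MvPowerSeries.X_pow_eq, MvPowerSeries.X_pow_eq, mul_left_comm,
      MvPowerSeries.monomial_mul_monomial, mul_one, MvPowerSeries.coeff_C_mul,
      MvPowerSeries.coeff_monomial, coeff_monomial]
    simp only [hiff]
    by_cases h0 : e 0 = n <;> by_cases h1 : m = e 1 <;> simp [h0, h1]

theorem hasSubst_chart (v w : Fin 2 → ℂ) :
    MvPowerSeries.HasSubst fun k : Fin 2 => (MvPowerSeries.X 0 : Ser) * chartDir v w k :=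
  MvPowerSeries.hasSubst_of_constantCoeff_zero fun k => by simp

theorem coeff_prod_chart (v w : Fin 2 → ℂ) (d e : Fin 2 →₀ ℕ) :
    MvPowerSeries.coeff e (d.prod fun k i => ((MvPowerSeries.X 0 : Ser) * chartDir v w k) ^ i) =
      if e 0 = d.degree then
        ((C (v 0) + C (w 0) * X) ^ d 0 * (C (v 1) + C (w 1) * X) ^ d 1).coeff (e 1) else 0 := by
  have hdir : ∀ k, chartDir v w k = aeval (MvPowerSeries.X 1 : Ser) (C (v k) + C (w k) * X) :=
    fun k => by
      rw [chartDir, map_add, map_mul, aeval_C, aeval_C, aeval_X]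
      rfl
  rw [← coeff_X_pow_mul_aeval, Finsupp.prod_fintype _ _ (by simp), Fin.prod_univ_two,
    map_mul (aeval _), map_pow (aeval _), map_pow (aeval _), ← hdir, ← hdir, mul_pow, mul_pow,
    degree_fin_two, pow_add, mul_mul_mul_comm]

theorem coeff_pull (v w : Fin 2 → ℂ) (f : Ser) (e : Fin 2 →₀ ℕ) :
    MvPowerSeries.coeff e (pull v w f) = (lineEval v w (homPart (e 0) f)).coeff (e 1) := by
  rw [pull, MvPowerSeries.coeff_subst (hasSubst_chart v w), lineEval_eq_sum, finsetSum_coeff,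
    finsum_eq_finsetSum_of_support_subset (s := (homPart (e 0) f).support)]
  · refine Finset.sum_congr rfl fun d hd => ?_
    rw [MvPolynomial.mem_support_iff, coeff_homPart, ne_eq, ite_eq_right_iff, Classical.not_imp]
      at hd
    rw [coeff_prod_chart, coeff_homPart, if_pos hd.1, if_pos hd.1.symm, coeff_C_mul, smul_eq_mul]
  · intro d hd
    rw [Function.mem_support, coeff_prod_chart] at hd
    rw [Finset.mem_coe, MvPolynomial.mem_support_iff, coeff_homPart]
    split_ifs at hd with h
    · rw [if_pos h.symm]
      exact (smul_ne_zero_iff.1 hd).1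
    · simp at hd

theorem coeff_single_pull (v w : Fin 2 → ℂ) (f : Ser) (n : ℕ) :
    MvPowerSeries.coeff (Finsupp.single 0 n) (pull v w f) = MvPolynomial.eval v (homPart n f) := by
  rw [coeff_pull]
  simp [coeff_zero_eq_eval_zero, eval_lineEval]

theorem X_pow_dvd_pull (v w : Fin 2 → ℂ) {f : Ser} {n : ℕ} (h : n ≤ f.order) :
    (MvPowerSeries.X 0 : Ser) ^ n ∣ pull v w f := by
  refine MvPowerSeries.X_pow_dvd_iff.2 fun e he => ?_
  rw [coeff_pull, homPart_eq_zero (lt_of_lt_of_le (by exact_mod_cast he) h), map_zero, coeff_zero]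

theorem norm_coeff_linear_pow_mul_le (c d : ℂ) {q : ℂ[X]} {B : ℝ} (h : ∀ m, ‖q.coeff m‖ ≤ B)
    (i m : ℕ) : ‖((C c + C d * X) ^ i * q).coeff m‖ ≤ (‖c‖ + ‖d‖) ^ i * B := by
  induction i generalizing m with
  | zero => simpa using h m
  | succ i ih =>
    have hshift : ‖(X * ((C c + C d * X) ^ i * q)).coeff m‖ ≤ (‖c‖ + ‖d‖) ^ i * B := by
      cases m with
      | zero => simpa using (norm_nonneg _).trans (ih 0)
      | succ m => rw [coeff_X_mul]; exact ih m
    rw [pow_succ', mul_assoc, add_mul, coeff_add, coeff_C_mul, mul_assoc, coeff_C_mul, pow_succ',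
      mul_assoc, add_mul]
    refine norm_add_le_of_le ?_ ?_ <;> rw [norm_mul]
    exacts [mul_le_mul_of_nonneg_left (ih m) (norm_nonneg _),
      mul_le_mul_of_nonneg_left hshift (norm_nonneg _)]

theorem norm_coeff_lineEval_homPart_le {f : Ser} {v w : Fin 2 → ℂ} {C R K : ℝ} (hC : 0 ≤ C)
    (hR : 0 ≤ R) (hf : ∀ d, ‖MvPowerSeries.coeff d f‖ ≤ C * R ^ d.degree)
    (hK : ∀ k, ‖v k‖ + ‖w k‖ ≤ K) (n m : ℕ) :
    ‖(lineEval v w (homPart n f)).coeff m‖ ≤ C * (2 * (R * K)) ^ n := by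
  have hK0 : 0 ≤ K := (add_nonneg (norm_nonneg _) (norm_nonneg _)).trans (hK 0)
  have hterm : ∀ p ∈ Finset.HasAntidiagonal.antidiagonal n,
      ‖(lineEval v w (MvPolynomial.monomial (Finsupp.single 0 p.1 + Finsupp.single 1 p.2)
        (MvPowerSeries.coeff (Finsupp.single 0 p.1 + Finsupp.single 1 p.2) f))).coeff m‖ ≤
        C * (R * K) ^ n := fun p hp => by
    obtain rfl := Finset.HasAntidiagonal.mem_antidiagonal.1 hp
    have hone : ∀ m, ‖(1 : ℂ[X]).coeff m‖ ≤ 1 := fun m => by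
      rw [coeff_one]
      split_ifs <;> simp
    have hlin := norm_coeff_linear_pow_mul_le (v 0) (w 0)
      (norm_coeff_linear_pow_mul_le (v 1) (w 1) hone p.2) p.1 m
    have hcoeff := hf (Finsupp.single 0 p.1 + Finsupp.single 1 p.2)
    rw [map_add, Finsupp.degree_single, Finsupp.degree_single] at hcoeff
    rw [mul_one, mul_one] at hlin
    rw [lineEval_monomial, coeff_C_mul, norm_mul, mul_pow, ← mul_assoc, pow_add K]
    refine mul_le_mul hcoeff ?_ (norm_nonneg _) (by positivity)
    simpa using hlin.trans (by gcongr <;> exact hK _)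
  rw [homPart, map_sum, finsetSum_coeff]
  refine (norm_sum_le_of_le _ hterm).trans ?_
  rw [Finset.sum_const, Finset.Nat.card_antidiagonal, nsmul_eq_mul, mul_pow 2, mul_left_comm]
  gcongr
  exact_mod_cast Nat.lt_two_pow_self.nat_succ_le

theorem Converges.pull {f : Ser} (hf : Converges f) (v w : Fin 2 → ℂ) : Converges (pull v w f) := by
  obtain ⟨C, R, hC, hR, h⟩ := hf.exists_norm_coeff_le
  obtain ⟨K, hK1, hK⟩ : ∃ K : ℝ, 1 ≤ K ∧ ∀ k, ‖v k‖ + ‖w k‖ ≤ K :=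
    ⟨1 + ∑ k, (‖v k‖ + ‖w k‖), le_add_of_nonneg_right (by positivity), fun k =>
      (Finset.single_le_sum (f := fun k => ‖v k‖ + ‖w k‖) (fun _ _ => by positivity)
        (Finset.mem_univ k)).trans (le_add_of_nonneg_left zero_le_one)⟩
  refine ⟨C, 2 * (R * K), fun e => ?_⟩
  rw [coeff_pull]
  refine (norm_coeff_lineEval_homPart_le hC (by positivity) h hK _ _).trans ?_
  gcongr
  · nlinarith
  · exact Nat.le_add_right _ _

theorem converges_X (k : Fin 2) : Converges (MvPowerSeries.X k) := by
  classical
  refine ⟨1, 1, fun n => ?_⟩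
  rw [MvPowerSeries.coeff_X]
  split_ifs <;> simp

theorem converges_chartDir (v w : Fin 2 → ℂ) (k : Fin 2) : Converges (chartDir v w k) :=
  (converges_C _).add ((converges_C _).mul (converges_X 1))

theorem Converges.exists_eq_X_pow_mul {f : Ser} (hf : Converges f) {n : ℕ}
    (h : (MvPowerSeries.X 0 : Ser) ^ n ∣ f) :
    ∃ u : O, f = (MvPowerSeries.X 0 : Ser) ^ n * u ∧
      MvPowerSeries.constantCoeff (u : Ser) = MvPowerSeries.coeff (Finsupp.single 0 n) f := by
  obtain ⟨u, hu⟩ := h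
  have hcoeff : ∀ d, MvPowerSeries.coeff d u = MvPowerSeries.coeff (Finsupp.single 0 n + d) f :=
    fun d => by rw [hu, MvPowerSeries.X_pow_eq, MvPowerSeries.coeff_add_monomial_mul, one_mul]
  obtain ⟨C, R, -, -, hb⟩ := hf.exists_norm_coeff_le
  have hu : Converges u := converges_of_norm_coeff_le (C := C * R ^ n) (R := R) fun d => by
    have hd := hb (Finsupp.single 0 n + d)
    rwa [map_add, Finsupp.degree_single, pow_add, ← mul_assoc, ← hcoeff] at hd
  refine ⟨⟨u, hu⟩, ‹_›, ?_⟩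
  rw [← MvPowerSeries.coeff_zero_eq_constantCoeff_apply]
  exact (hcoeff 0).trans (by rw [add_zero])

end PullBack

section Transversality

theorem X_zero_ne_zero : (MvPowerSeries.X 0 : Ser) ≠ 0 := fun h =>
  one_ne_zero <| by
    rw [← MvPowerSeries.coeff_index_single_self_X (R := ℂ) (0 : Fin 2), h, map_zero]

theorem transversalToDivisor_of_X_pow_dvd {A B : Ser} (hA : Converges A) (hB : Converges B) {m : ℕ}
    (hdA : (MvPowerSeries.X 0 : Ser) ^ m ∣ A) (hdB : (MvPowerSeries.X 0 : Ser) ^ m ∣ B)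
    (hne : MvPowerSeries.coeff (Finsupp.single 0 m) B ≠ 0) : TransversalToDivisor A B := by
  obtain ⟨a, ha, -⟩ := hA.exists_eq_X_pow_mul hdA
  obtain ⟨b, hb, hb0⟩ := hB.exists_eq_X_pow_mul hdB
  refine ⟨⟨_, converges_X 0⟩ ^ m, a, b, pow_ne_zero _ fun h => X_zero_ne_zero ?_, ?_, ?_, ?_⟩
  · exact congrArg Subtype.val h
  · simpa using ha
  · simpa using hb
  · rwa [hb0]

theorem pull_radial (v w : Fin 2 → ℂ) (A B : Ser) :
    pull v w (A * MvPowerSeries.X 0 + B * MvPowerSeries.X 1) =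
      MvPowerSeries.X 0 * (pull v w A * chartDir v w 0 + pull v w B * chartDir v w 1) := by
  have hs := hasSubst_chart v w
  simp only [pull, MvPowerSeries.subst_add hs, MvPowerSeries.subst_mul hs,
    MvPowerSeries.subst_X hs]
  ring

/-- The extra order of vanishing of the contraction of `A dx + B dy` with the radial vector field
lets one divide the pull-back by one more power of the equation of `D`; what is left of the
coefficient of `ds` at `[v]` is the leading part of `A dx + B dy` at `v`, evaluated on `w`. -/
theorem transversalToDivisor_pull {A B : Ser} (hA : Converges A) (hB : Converges B) {n : ℕ}
    {p q : MvPolynomial (Fin 2) ℂ} (hp : HasLeadForm n A p) (hq : HasLeadForm n B q)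
    (hrad : ((n + 2 : ℕ) : ℕ∞) ≤ (A * MvPowerSeries.X 0 + B * MvPowerSeries.X 1).order)
    {v w : Fin 2 → ℂ} (hne : w 0 * MvPolynomial.eval v p + w 1 * MvPolynomial.eval v q ≠ 0) :
    TransversalToDivisor (pull v w A * chartDir v w 0 + pull v w B * chartDir v w 1)
      (MvPowerSeries.X 0 *
        (MvPowerSeries.C (w 0) * pull v w A + MvPowerSeries.C (w 1) * pull v w B)) := by
  have hdx := X_pow_dvd_pull v w hrad
  rw [pull_radial, pow_succ', mul_dvd_mul_iff_left X_zero_ne_zero] at hdx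
  have hds := dvd_add ((X_pow_dvd_pull v w hp.le_order).mul_left (MvPowerSeries.C (w 0)))
    ((X_pow_dvd_pull v w hq.le_order).mul_left (MvPowerSeries.C (w 1)))
  refine transversalToDivisor_of_X_pow_dvd
    (((hA.pull v w).mul (converges_chartDir v w 0)).add
      ((hB.pull v w).mul (converges_chartDir v w 1)))
    ((converges_X 0).mul (((converges_C (w 0)).mul (hA.pull v w)).add
      ((converges_C (w 1)).mul (hB.pull v w)))) hdx ?_ ?_
  · rw [pow_succ']
    exact mul_dvd_mul_left _ hds
  · have hexp : (Finsupp.single 0 (n + 1) : Fin 2 →₀ ℕ) =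
        Finsupp.single 0 1 + Finsupp.single 0 n := by rw [← Finsupp.single_add, add_comm]
    rw [hexp, MvPowerSeries.X, MvPowerSeries.coeff_add_monomial_mul, one_mul, map_add,
      MvPowerSeries.coeff_C_mul, MvPowerSeries.coeff_C_mul, coeff_single_pull, coeff_single_pull,
      hp.homPart_eq, hq.homPart_eq]
    exact hne

end Transversality

section LineEval

theorem derivative_lineEval (v w : Fin 2 → ℂ) (p : MvPolynomial (Fin 2) ℂ) :
    derivative (lineEval v w p) = lineEval v w (MvPolynomial.C (w 0) * MvPolynomial.pderiv 0 p +
      MvPolynomial.C (w 1) * MvPolynomial.pderiv 1 p) := by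
  rw [map_add, map_mul, map_mul, lineEval_C, lineEval_C]
  induction p using MvPolynomial.induction_on with
  | C a => simp
  | add p q hp hq =>
    simp only [map_add, hp, hq]
    ring
  | mul_X p k hp =>
    simp only [map_mul, derivative_mul, hp, MvPolynomial.pderiv_mul, map_add, lineEval_X]
    fin_cases k <;> simp <;> ring

theorem natDegree_linear_pow_le (a b : ℂ) (n : ℕ) : ((C a + C b * X) ^ n).natDegree ≤ n := by
  compute_degree

theorem coeff_linear_pow (a b : ℂ) (n : ℕ) : ((C a + C b * X) ^ n).coeff n = b ^ n := by
  have h := coeff_pow_of_natDegree_le (p := C a + C b * X) (n := 1) (m := n) (by compute_degree)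
  simpa using h

variable {p : MvPolynomial (Fin 2) ℂ} {n : ℕ}

theorem natDegree_lineEval_le (hp : p.IsHomogeneous n) (v w : Fin 2 → ℂ) :
    (lineEval v w p).natDegree ≤ n := by
  rw [lineEval_eq_sum]
  refine natDegree_sum_le_of_forall_le _ _ fun d hd => (natDegree_C_mul_le _ _).trans ?_
  rw [show n = d.degree from hp.degree_eq_sum_deg_support hd, degree_fin_two]
  exact natDegree_mul_le.trans
    (add_le_add (natDegree_linear_pow_le _ _ _) (natDegree_linear_pow_le _ _ _))

theorem coeff_lineEval (hp : p.IsHomogeneous n) (v w : Fin 2 → ℂ) :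
    (lineEval v w p).coeff n = MvPolynomial.eval w p := by
  rw [lineEval_eq_sum, MvPolynomial.eval_eq', finsetSum_coeff]
  refine Finset.sum_congr rfl fun d hd => ?_
  rw [coeff_C_mul, show n = d.degree from hp.degree_eq_sum_deg_support hd, degree_fin_two,
    Fin.prod_univ_two, coeff_mul_add_eq_of_natDegree_le (natDegree_linear_pow_le _ _ _)
      (natDegree_linear_pow_le _ _ _), coeff_linear_pow, coeff_linear_pow]

end LineEval

section HomogeneousPolynomials

variable {σ R : Type*} [CommRing R]

theorem eval_smul_of_isHomogeneous {p : MvPolynomial σ R} {n : ℕ} (hp : p.IsHomogeneous n)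
    (c : R) (v : σ → R) : MvPolynomial.eval (c • v) p = c ^ n * MvPolynomial.eval v p := by
  rw [MvPolynomial.eval_eq, MvPolynomial.eval_eq, Finset.mul_sum]
  refine Finset.sum_congr rfl fun d hd => ?_
  simp only [Pi.smul_apply, smul_eq_mul, mul_pow, Finset.prod_mul_distrib,
    Finset.prod_pow_eq_pow_sum]
  rw [hp.degree_eq_sum_deg_support hd, mul_left_comm]

theorem exists_isHomogeneous_of_X_mul {p : MvPolynomial σ R} {i : σ} {n : ℕ} (hp : p ≠ 0)
    (h : (MvPolynomial.X i * p).IsHomogeneous n) : ∃ m, n = m + 1 ∧ p.IsHomogeneous m := by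
  have hdeg : ∀ d, p.coeff d ≠ 0 → n = d.degree + 1 := fun d hd => by
    have hne : (MvPolynomial.X i * p).coeff (Finsupp.single i 1 + d) ≠ 0 := by
      rwa [MvPolynomial.coeff_X_mul]
    by_contra hn
    refine hne (h.coeff_eq_zero ?_)
    rw [map_add, Finsupp.degree_single]
    omega
  obtain ⟨d, hd⟩ := MvPolynomial.ne_zero_iff.1 hp
  refine ⟨d.degree, hdeg d hd, fun e he => ?_⟩
  have hd' := hdeg d hd
  have he' := hdeg e he
  calc Finsupp.weight 1 e = e.degree := by rw [Finsupp.degree_eq_weight_one]; rfl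
    _ = d.degree := by omega

theorem exists_eq_X_mul_of_X_mul_add_X_mul_eq_zero [IsDomain R] {p q : MvPolynomial σ R} {i j : σ}
    (hij : i ≠ j) (h : MvPolynomial.X i * p + MvPolynomial.X j * q = 0) :
    ∃ g, p = MvPolynomial.X j * g ∧ q = -(MvPolynomial.X i * g) := by
  have hdvd : (MvPolynomial.X j : MvPolynomial σ R) ∣ MvPolynomial.X i * p :=
    ⟨-q, by linear_combination h⟩
  obtain ⟨g, rfl⟩ := (MvPolynomial.X_prime.dvd_or_dvd hdvd).resolve_left fun hX =>
    hij.symm (MvPolynomial.X_dvd_X.1 hX)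
  exact ⟨g, rfl, mul_left_cancel₀ (MvPolynomial.X_ne_zero j) (by linear_combination h)⟩

end HomogeneousPolynomials

section LogDerivative

variable {ι K A B : Type*} [Fintype ι] [CommRing K] [CommRing A] [CommRing B] [Algebra K A]
  [Algebra K B]

/-- The numerator of `∑ i, c i • D (p i) / p i` over the denominator `∏ i, p i`, for an operator `D`
such as a partial derivative. -/
def logDerivNum (D : A → A) (c : ι → K) (p : ι → A) : A :=
  open Classical in
  ∑ i, c i • ((∏ j ∈ Finset.univ.erase i, p j) * D (p i))

theorem map_logDerivNum (φ : A →ₐ[K] B) {D : A → A} {D' : B → B} (h : ∀ q, φ (D q) = D' (φ q))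
    (c : ι → K) (p : ι → A) :
    φ (logDerivNum D c p) = logDerivNum D' c fun i => φ (p i) := by
  simp only [logDerivNum, map_sum, map_smul, map_mul, map_prod, h]

theorem mul_logDerivNum_add (a b : A) (D₁ D₂ : A → A) (c : ι → K) (p : ι → A) :
    a * logDerivNum D₁ c p + b * logDerivNum D₂ c p =
      logDerivNum (fun q => a * D₁ q + b * D₂ q) c p := by
  simp only [logDerivNum, Finset.mul_sum, ← Finset.sum_add_distrib, mul_smul_comm, ← smul_add]
  exact Finset.sum_congr rfl fun i _ => congrArg _ (by ring)

theorem logDerivNum_eq_smul_prod {D : A → A} {n : ι → K} {p : ι → A}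
    (h : ∀ i, D (p i) = n i • p i) (c : ι → K) :
    logDerivNum D c p = (∑ i, n i * c i) • ∏ i, p i := by
  classical
  rw [logDerivNum, Finset.sum_smul]
  refine Finset.sum_congr rfl fun i hi => ?_
  rw [h, mul_smul_comm, Finset.prod_erase_mul _ _ hi, smul_smul, mul_comm]

theorem derivative_prod_X_sub_C_pow_mul_nodal [DecidableEq K] (S : Finset K) (m : K → ℕ) :
    derivative (∏ a ∈ S, (X - C a) ^ m a) * nodal S id =
      (∏ a ∈ S, (X - C a) ^ m a) * polarNum S fun a => (m a : K) := by
  simp only [derivative_prod_finset, polarNum, Finset.sum_mul, Finset.mul_sum]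
  refine Finset.sum_congr rfl fun a ha => ?_
  have hpow : derivative ((X - C a) ^ m a) * (X - C a) = C (m a : K) * (X - C a) ^ m a := by
    cases hm : m a with
    | zero => simp
    | succ k => rw [derivative_X_sub_C_pow, Nat.add_sub_cancel, mul_assoc, ← pow_succ]
  rw [nodal_eq_mul_nodal_erase ha, ← Finset.mul_prod_erase S _ ha, id]
  linear_combination (∏ b ∈ S.erase a, (X - C b) ^ m b) * nodal (S.erase a) id * hpow

end LogDerivative

section LogDerivativeSplits

variable {ι K : Type*} [Field K] [IsAlgClosed K] [DecidableEq K] {S : Finset K}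

theorem derivative_mul_nodal {p : K[X]} (hp : p ≠ 0) (hS : ∀ a, p.IsRoot a → a ∈ S) :
    derivative p * nodal S id = p * polarNum S fun a => (p.rootMultiplicity a : K) := by
  have hprod : p = C p.leadingCoeff * ∏ a ∈ S, (X - C a) ^ p.rootMultiplicity a := by
    conv_lhs => rw [(IsAlgClosed.splits p).eq_prod_roots, prod_multiset_root_eq_finset_root]
    refine congrArg _ (Finset.prod_subset (fun a ha => hS a ?_) fun a _ ha => ?_)
    · exact isRoot_of_mem_roots (Multiset.mem_toFinset.1 ha)
    · rw [Multiset.mem_toFinset, mem_roots hp] at ha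
      rw [rootMultiplicity_eq_zero ha, pow_zero]
  conv_lhs => rw [hprod, derivative_C_mul, mul_assoc, derivative_prod_X_sub_C_pow_mul_nodal,
    ← mul_assoc, ← hprod]

theorem polarNum_mul_prod_eq_logDerivNum_mul_nodal [Fintype ι] (c : ι → K) {p : ι → K[X]}
    (hp : ∀ i, p i ≠ 0) (hS : ∀ i a, (p i).IsRoot a → a ∈ S) :
    polarNum S (fun a => ∑ i, c i * ((p i).rootMultiplicity a : K)) * ∏ i, p i =
      logDerivNum derivative c p * nodal S id := by
  classical
  rw [polarNum_sum, logDerivNum, Finset.sum_mul, Finset.sum_mul]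
  refine Finset.sum_congr rfl fun i hi => ?_
  rw [polarNum_const_mul, ← Finset.prod_erase_mul _ _ hi, smul_eq_C_mul]
  linear_combination (-C (c i) * ∏ j ∈ Finset.univ.erase i, p j) *
    derivative_mul_nodal (hp i) (hS i)

end LogDerivativeSplits

namespace LogForm

variable {ι : Type*}

theorem hasLeadForm_f (η : LogForm ι) (i : ι) :
    HasLeadForm (ord (η.f i)) (η.f i) (initForm (η.f i)) :=
  hasLeadForm_initForm (η.irreducible i).ne_zero

theorem ord_pos (η : LogForm ι) (i : ι) : 0 < ord (η.f i) :=
  one_le_ord_of_irreducible (η.irreducible i)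

variable [Fintype ι]

/-- The order of `f = ∏ i, f i`. -/
def totalOrd (η : LogForm ι) : ℕ := ∑ i, ord (η.f i)

/-- The homogeneous component of degree `ν₀(f) - 1` of the `k`-th coefficient of `f η`. -/
def leadForm (η : LogForm ι) (k : Fin 2) : MvPolynomial (Fin 2) ℂ :=
  logDerivNum (MvPolynomial.pderiv k) η.res fun i => initForm (η.f i)

variable {η : LogForm ι}

theorem order_F (η : LogForm ι) : η.F.order = η.totalOrd := by
  rw [F, MvPowerSeries.order_prod, totalOrd, Nat.cast_sum]
  exact Finset.sum_congr rfl fun i _ => order_eq_ord (η.irreducible i).ne_zero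

theorem hasLeadForm_polarPart {N : ℕ} (hN : η.totalOrd = N + 1) (k : Fin 2) :
    HasLeadForm N (η.polarPart k) (η.leadForm k) := by
  classical
  refine HasLeadForm.sum fun i hi => HasLeadForm.smul _ ?_
  obtain ⟨m, hm⟩ := Nat.exists_eq_add_of_le' (η.ord_pos i)
  have hsum : ∑ j ∈ Finset.univ.erase i, ord (η.f j) + m = N := by
    have h := Finset.sum_erase_add Finset.univ (fun j => ord (η.f j)) hi
    rw [totalOrd] at hN
    omega
  have hf := η.hasLeadForm_f i
  rw [hm] at hf
  have h := (HasLeadForm.prod fun j (_ : j ∈ Finset.univ.erase i) => η.hasLeadForm_f j).mul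
    (hf.pderiv k)
  rwa [hsum] at h

theorem hasLeadForm_polarPart_add {N : ℕ} (hN : η.totalOrd = N + 1) (k : Fin 2) (a : Ser) :
    HasLeadForm N (η.polarPart k + η.F * a) (η.leadForm k) := by
  have hF : (N : ℕ∞) < (η.F * a).order := by
    rw [MvPowerSeries.order_mul, order_F, hN]
    exact lt_of_lt_of_le (by exact_mod_cast N.lt_succ_self) le_self_add
  simpa using (hasLeadForm_polarPart hN k).add (hasLeadForm_zero_of_lt_order hF)

theorem hasLeadForm_ωx {N : ℕ} (hN : η.totalOrd = N + 1) : HasLeadForm N η.ωx (η.leadForm 0) :=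
  hasLeadForm_polarPart_add hN 0 _

theorem hasLeadForm_ωy {N : ℕ} (hN : η.totalOrd = N + 1) : HasLeadForm N η.ωy (η.leadForm 1) :=
  hasLeadForm_polarPart_add hN 1 _

theorem converges_polarPart_add (η : LogForm ι) (k : Fin 2) (a : O) :
    Converges (η.polarPart k + η.F * (a : Ser)) := by
  classical
  have hprod : ∀ s : Finset ι, Converges (∏ j ∈ s, (η.f j : Ser)) := fun s =>
    O.prod_mem fun j _ => (η.f j).2
  refine Converges.add ?_ ((hprod _).mul a.2)
  exact O.sum_mem fun i _ => ((hprod _).mul ((η.f i).2.pderiv k)).smul _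

theorem MainResonant.euler_leadForm (h : η.MainResonant) :
    MvPolynomial.X 0 * η.leadForm 0 + MvPolynomial.X 1 * η.leadForm 1 = 0 := by
  have heuler : ∀ i, MvPolynomial.X 0 * MvPolynomial.pderiv 0 (initForm (η.f i)) +
      MvPolynomial.X 1 * MvPolynomial.pderiv 1 (initForm (η.f i)) =
        (ord (η.f i) : ℂ) • initForm (η.f i) := fun i => by
    rw [← Fin.sum_univ_two fun k => MvPolynomial.X k * MvPolynomial.pderiv k (initForm (η.f i)),
      (η.hasLeadForm_f i).isHomogeneous.sum_X_mul_pderiv, Nat.cast_smul_eq_nsmul]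
  rw [leadForm, leadForm, mul_logDerivNum_add, logDerivNum_eq_smul_prod heuler, h, zero_smul]

/-- The leading part of the `1`-form `f η` is the multiple `g (y dx - x dy)` of the radial form.
Then the strict transform is transversal to `D` away from the zeros of `g`. -/
structure IsRadialFactor (η : LogForm ι) (g : MvPolynomial (Fin 2) ℂ) : Prop where
  leadForm_zero : η.leadForm 0 = MvPolynomial.X 1 * g
  leadForm_one : η.leadForm 1 = -(MvPolynomial.X 0 * g)

theorem MainResonant.exists_isRadialFactor (h : η.MainResonant) : ∃ g, η.IsRadialFactor g :=
  let ⟨g, h₀, h₁⟩ := exists_eq_X_mul_of_X_mul_add_X_mul_eq_zero Fin.zero_ne_one h.euler_leadForm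
  ⟨g, h₀, h₁⟩

namespace IsRadialFactor

variable {g : MvPolynomial (Fin 2) ℂ}

theorem exists_totalOrd_eq (hg : η.IsRadialFactor g) (h : g ≠ 0) :
    ∃ M, η.totalOrd = M + 2 ∧ g.IsHomogeneous M := by
  have hlead : η.leadForm 0 ≠ 0 := by
    rw [hg.leadForm_zero]
    exact mul_ne_zero (MvPolynomial.X_ne_zero 1) h
  obtain ⟨i, hi, -⟩ := Finset.exists_ne_zero_of_sum_ne_zero hlead
  obtain ⟨N, hN⟩ : ∃ N, η.totalOrd = N + 1 :=
    Nat.exists_eq_add_of_le' ((η.ord_pos i).trans_le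
      (Finset.single_le_sum (f := fun i => ord (η.f i)) (fun _ _ => Nat.zero_le _) hi))
  have hhom := (hasLeadForm_ωx hN).isHomogeneous
  rw [hg.leadForm_zero] at hhom
  obtain ⟨M, rfl, hM⟩ := exists_isHomogeneous_of_X_mul h hhom
  exact ⟨M, hN, hM⟩

theorem ne_zero (hg : η.IsRadialFactor g) (h : η.OneFaithful) : g ≠ 0 := by
  rintro rfl
  rw [OneFaithful, order_F] at h
  obtain ⟨N, hN⟩ : ∃ N, η.totalOrd = N + 1 :=
    Nat.exists_eq_succ_of_ne_zero fun h0 => by simp [h0] at h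
  rw [hN, Nat.cast_add, Nat.cast_one] at h
  replace h := ENat.add_left_injective_of_ne_top ENat.one_ne_top h
  rcases min_choice η.ωx.order η.ωy.order with hm | hm <;> rw [hm] at h
  · exact (hasLeadForm_ωx hN).ne_zero_of_order_eq h.symm (by rw [hg.leadForm_zero, mul_zero])
  · exact (hasLeadForm_ωy hN).ne_zero_of_order_eq h.symm
      (by rw [hg.leadForm_one, mul_zero, neg_zero])

theorem le_order_radial (hg : η.IsRadialFactor g) {N : ℕ} (hN : η.totalOrd = N + 1) :
    ((N + 2 : ℕ) : ℕ∞) ≤ (η.ωx * MvPowerSeries.X 0 + η.ωy * MvPowerSeries.X 1).order := by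
  have h := ((hasLeadForm_ωx hN).mul (hasLeadForm_X 0)).add
    ((hasLeadForm_ωy hN).mul (hasLeadForm_X 1))
  have hzero : η.leadForm 0 * MvPolynomial.X 0 + η.leadForm 1 * MvPolynomial.X 1 = 0 := by
    rw [hg.leadForm_zero, hg.leadForm_one]
    ring
  rw [hzero] at h
  exact h.succ_le_order

theorem not_isEscapePoint (hg : η.IsRadialFactor g) {v : Fin 2 → ℂ}
    (hv : MvPolynomial.eval v g ≠ 0) : ¬ η.IsEscapePoint v := by
  rintro ⟨-, -, w, hdet, hnot⟩
  obtain ⟨M, hM, -⟩ := hg.exists_totalOrd_eq fun h => hv (by rw [h, map_zero])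
  refine hnot (transversalToDivisor_pull (η.converges_polarPart_add 0 η.αx)
    (η.converges_polarPart_add 1 η.αy) (hasLeadForm_ωx hM) (hasLeadForm_ωy hM)
    (hg.le_order_radial hM) ?_)
  have heval : w 0 * MvPolynomial.eval v (η.leadForm 0) + w 1 * MvPolynomial.eval v (η.leadForm 1) =
      -((v 0 * w 1 - v 1 * w 0) * MvPolynomial.eval v g) := by
    rw [hg.leadForm_zero, hg.leadForm_one]
    simp only [map_mul, map_neg, MvPolynomial.eval_X]
    ring
  rw [heval]
  exact neg_ne_zero.2 (mul_ne_zero hdet hv)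

end IsRadialFactor

end LogForm

section Coordinates

/-- The `j`-th vector of the basis of `ℂ²` given by the real coordinates `E`: the affine coordinate
`t` on `D` is that of the line through `col E 0 + t • col E 1`. -/
def col (E : GL (Fin 2) ℝ) (j : Fin 2) : Fin 2 → ℂ := fun k => ((E k j : ℝ) : ℂ)

theorem det_col_ne_zero (E : GL (Fin 2) ℝ) :
    col E 0 0 * col E 1 1 - col E 1 0 * col E 0 1 ≠ 0 := by
  have h : (E : Matrix (Fin 2) (Fin 2) ℝ).det ≠ 0 := E.det_ne_zero
  rw [Matrix.det_fin_two] at h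
  simp only [col]
  exact_mod_cast fun h0 => h (by linear_combination h0)

theorem exists_col_one_eq {u : Fin 2 → ℝ} (hu : u 0 ≠ 0) :
    ∃ E : GL (Fin 2) ℝ, col E 1 = fun k => (u k : ℂ) := by
  have hdet : (!![0, u 0; 1, u 1] : Matrix (Fin 2) (Fin 2) ℝ).det ≠ 0 := by
    rw [Matrix.det_fin_two_of]
    simpa using hu
  refine ⟨Matrix.GeneralLinearGroup.mkOfDetNeZero _ hdet, funext fun k => ?_⟩
  fin_cases k <;> simp [col, Matrix.GeneralLinearGroup.mkOfDetNeZero]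

theorem exists_ofReal_eq_smul_col (E : GL (Fin 2) ℝ) {v : Fin 2 → ℂ}
    (hv : ∀ k, v k ∈ Set.range ((↑) : ℝ → ℂ)) (hv0 : v ≠ 0) :
    ∃ c : ℂ, c ≠ 0 ∧ (v = c • col E 1 ∨ ∃ t : ℝ, v = c • (col E 0 + (t : ℂ) • col E 1)) := by
  choose x hx using hv
  set u := (E⁻¹ : Matrix (Fin 2) (Fin 2) ℝ).mulVec x with hu
  have hxu : x = (E : Matrix (Fin 2) (Fin 2) ℝ).mulVec u := by
    rw [hu, Matrix.mulVec_mulVec, Matrix.mul_nonsing_inv _ E.det_ne_zero.isUnit, Matrix.one_mulVec]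
  have h : v = (u 0 : ℂ) • col E 0 + (u 1 : ℂ) • col E 1 := by
    ext k
    rw [← hx, hxu, Matrix.mulVec, dotProduct, Fin.sum_univ_two]
    simp [col, mul_comm]
  by_cases h0 : (u 0 : ℂ) = 0
  · rw [h0, zero_smul, zero_add] at h
    exact ⟨u 1, left_ne_zero_of_smul (h ▸ hv0), Or.inl h⟩
  · refine ⟨u 0, h0, Or.inr ⟨u 1 / u 0, ?_⟩⟩
    rw [h, smul_add, smul_smul, Complex.ofReal_div, mul_div_cancel₀ _ h0]

theorem conePoly_eq_lineEval (E : GL (Fin 2) ℝ) (f : O) :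
    conePoly E f = lineEval (col E 0) (col E 1) (initForm f) := rfl

variable {E : GL (Fin 2) ℝ} {f : O}

theorem coeff_conePoly_ord (E : GL (Fin 2) ℝ) (hf : f ≠ 0) :
    (conePoly E f).coeff (ord f) = MvPolynomial.eval (col E 1) (initForm f) :=
  coeff_lineEval (hasLeadForm_initForm hf).isHomogeneous _ _

theorem natDegree_conePoly (hf : f ≠ 0) (h : MvPolynomial.eval (col E 1) (initForm f) ≠ 0) :
    (conePoly E f).natDegree = ord f :=
  natDegree_eq_of_le_of_coeff_ne_zero
    (natDegree_lineEval_le (hasLeadForm_initForm hf).isHomogeneous _ _)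
    (by rwa [coeff_conePoly_ord E hf])

theorem conePoly_ne_zero (hf : f ≠ 0) (h : MvPolynomial.eval (col E 1) (initForm f) ≠ 0) :
    conePoly E f ≠ 0 := fun h0 => h (by rw [← coeff_conePoly_ord E hf, h0, coeff_zero])

end Coordinates

namespace LogForm

variable {ι : Type*} [Fintype ι] {η : LogForm ι} {E : GL (Fin 2) ℝ}

theorem mem_cone {a : ℂ} : a ∈ η.cone E ↔ ∃ i, a ∈ (conePoly E (η.f i)).roots := by
  simp [cone]

theorem escapePoly_mul_prod_conePoly (hp : ∀ i, conePoly E (η.f i) ≠ 0) :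
    η.escapePoly E * ∏ i, conePoly E (η.f i) =
      logDerivNum derivative η.res (fun i => conePoly E (η.f i)) * nodal (η.cone E) id := by
  convert polarNum_mul_prod_eq_logDerivNum_mul_nodal η.res hp (S := η.cone E) fun i a ha =>
    mem_cone.2 ⟨i, (mem_roots (hp i)).2 ha⟩
  rfl

namespace IsRadialFactor

variable {g : MvPolynomial (Fin 2) ℂ}

theorem logDerivNum_conePoly (hg : η.IsRadialFactor g) (E : GL (Fin 2) ℝ) :
    logDerivNum derivative η.res (fun i => conePoly E (η.f i)) =
      C (-(col E 0 0 * col E 1 1 - col E 1 0 * col E 0 1)) * lineEval (col E 0) (col E 1) g := by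
  simp only [conePoly_eq_lineEval]
  rw [← map_logDerivNum (lineEval (col E 0) (col E 1))
    fun q => (derivative_lineEval (col E 0) (col E 1) q).symm, ← mul_logDerivNum_add]
  have h₀ := hg.leadForm_zero
  have h₁ := hg.leadForm_one
  rw [leadForm] at h₀ h₁
  rw [h₀, h₁]
  simp only [map_add, map_mul, map_neg, map_sub, lineEval_C, lineEval_X]
  ring

theorem escapePoly_mul_prod_conePoly (hg : η.IsRadialFactor g)
    (hp : ∀ i, conePoly E (η.f i) ≠ 0) :
    η.escapePoly E * ∏ i, conePoly E (η.f i) =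
      C (-(col E 0 0 * col E 1 1 - col E 1 0 * col E 0 1)) * lineEval (col E 0) (col E 1) g *
        nodal (η.cone E) id := by
  rw [LogForm.escapePoly_mul_prod_conePoly hp, hg.logDerivNum_conePoly]

theorem escapePoly_ne_zero_iff (hg : η.IsRadialFactor g) (hp : ∀ i, conePoly E (η.f i) ≠ 0) :
    η.escapePoly E ≠ 0 ↔ lineEval (col E 0) (col E 1) g ≠ 0 := by
  rw [← mul_ne_zero_iff_right (Finset.prod_ne_zero_iff.2 fun i _ => hp i),
    hg.escapePoly_mul_prod_conePoly hp, mul_ne_zero_iff_right nodal_ne_zero,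
    mul_ne_zero_iff_left (C_ne_zero.2 (neg_ne_zero.2 (det_col_ne_zero E)))]

theorem natDegree_escapePoly_add_totalOrd (hg : η.IsRadialFactor g)
    (he : ∀ i, MvPolynomial.eval (col E 1) (initForm (η.f i)) ≠ 0)
    (hL : lineEval (col E 0) (col E 1) g ≠ 0) :
    (η.escapePoly E).natDegree + η.totalOrd =
      (lineEval (col E 0) (col E 1) g).natDegree + (η.cone E).card := by
  have hp : ∀ i, conePoly E (η.f i) ≠ 0 := fun i =>
    conePoly_ne_zero (η.irreducible i).ne_zero (he i)
  have hprod : (∏ i, conePoly E (η.f i)).natDegree = η.totalOrd := by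
    rw [natDegree_prod _ _ fun i _ => hp i, totalOrd]
    exact Finset.sum_congr rfl fun i _ => natDegree_conePoly (η.irreducible i).ne_zero (he i)
  have hdet := neg_ne_zero.2 (det_col_ne_zero E)
  rw [← hprod, ← natDegree_mul ((hg.escapePoly_ne_zero_iff hp).2 hL)
      (Finset.prod_ne_zero_iff.2 fun i _ => hp i), hg.escapePoly_mul_prod_conePoly hp,
    natDegree_mul (mul_ne_zero (C_ne_zero.2 hdet) hL) nodal_ne_zero, natDegree_C_mul hdet,
    natDegree_nodal]

theorem adapted_iff (hg : η.IsRadialFactor g) :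
    η.Adapted E ↔ (∀ i, MvPolynomial.eval (col E 1) (initForm (η.f i)) ≠ 0) ∧
      MvPolynomial.eval (col E 1) g ≠ 0 := by
  refine and_congr_right fun he => ?_
  have hne := hg.escapePoly_ne_zero_iff fun i =>
    conePoly_ne_zero (η.irreducible i).ne_zero (he i)
  by_cases hg0 : g = 0
  · rw [hne, hg0]
    simp
  obtain ⟨M, hM, hhom⟩ := hg.exists_totalOrd_eq hg0
  have hdeg := hg.natDegree_escapePoly_add_totalOrd he
  have hle := natDegree_lineEval_le hhom (col E 0) (col E 1)
  rw [hne, ← coeff_lineEval hhom (col E 0) (col E 1)]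
  constructor
  · rintro ⟨hL, hP⟩
    have hLdeg := hdeg hL
    rw [show M = (lineEval (col E 0) (col E 1) g).natDegree by omega]
    exact leadingCoeff_ne_zero.2 hL
  · intro hcoeff
    have hL : lineEval (col E 0) (col E 1) g ≠ 0 := fun h => hcoeff (by rw [h, coeff_zero])
    have hLdeg := hdeg hL
    have := natDegree_eq_of_le_of_coeff_ne_zero hle hcoeff
    exact ⟨hL, by omega⟩

theorem eval_ne_zero_of_eval_escapePoly_ne_zero (hg : η.IsRadialFactor g)
    (hp : ∀ i, conePoly E (η.f i) ≠ 0) {t : ℂ} (ht : t ∉ η.cone E)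
    (h : (η.escapePoly E).eval t ≠ 0) :
    MvPolynomial.eval (col E 0 + t • col E 1) g ≠ 0 := by
  have hroot : ∀ i, (conePoly E (η.f i)).eval t ≠ 0 := fun i h0 =>
    ht (mem_cone.2 ⟨i, (mem_roots (hp i)).2 h0⟩)
  have heval := congrArg (eval t) (hg.escapePoly_mul_prod_conePoly hp)
  rw [eval_mul, eval_mul, eval_mul, eval_lineEval, eval_prod] at heval
  intro h0
  rw [h0, mul_zero, zero_mul] at heval
  exact mul_ne_zero h (Finset.prod_ne_zero_iff.2 fun i _ => hroot i) heval

theorem noRealEscapePoints (hg : η.IsRadialFactor g) (hE : η.Adapted E)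
    (h : ∀ t : ℝ, (t : ℂ) ∉ η.cone E → (η.escapePoly E).eval (t : ℂ) ≠ 0) :
    η.NoRealEscapePoints := by
  intro v hv
  refine hg.not_isEscapePoint ?_ hv
  obtain ⟨hv0, hcone, -⟩ := hv
  have hinf := (hg.adapted_iff.1 hE).2
  obtain ⟨M, -, hhom⟩ := hg.exists_totalOrd_eq (ne_of_apply_ne (MvPolynomial.eval (col E 1))
    (by rwa [map_zero]))
  obtain ⟨c, hc, hvc | ⟨t, hvc⟩⟩ := exists_ofReal_eq_smul_col E (fun k => ⟨v k, rfl⟩) hv0 <;>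
    rw [hvc, eval_smul_of_isHomogeneous hhom] <;> refine mul_ne_zero (pow_ne_zero M hc) ?_
  · exact hinf
  have ht : (t : ℂ) ∉ η.cone E := fun ht => by
    obtain ⟨i, hi⟩ := mem_cone.1 ht
    refine hcone i ?_
    rw [hvc, eval_smul_of_isHomogeneous (η.hasLeadForm_f i).isHomogeneous, ← eval_lineEval,
      ← conePoly_eq_lineEval, isRoot_of_mem_roots hi, mul_zero]
  exact hg.eval_ne_zero_of_eval_escapePoly_ne_zero
    (fun i => conePoly_ne_zero (η.irreducible i).ne_zero (hE.1 i)) ht (h t ht)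

end IsRadialFactor

theorem exists_adapted (hres : η.MainResonant) (hfaith : η.OneFaithful) :
    ∃ E : GL (Fin 2) ℝ, η.Adapted E := by
  obtain ⟨g, hg⟩ := hres.exists_isRadialFactor
  have hne : MvPolynomial.X 0 * g * ∏ i, initForm (η.f i) ≠ 0 := by
    refine mul_ne_zero (mul_ne_zero (MvPolynomial.X_ne_zero 0) (hg.ne_zero hfaith))
      (Finset.prod_ne_zero_iff.2 fun i _ => (η.hasLeadForm_f i).ne_zero_of_order_eq ?_)
    exact (order_eq_ord (η.irreducible i).ne_zero).symm
  obtain ⟨x, hx, hxp⟩ : ∃ x ∈ Set.univ.pi fun _ : Fin 2 => Set.range ((↑) : ℝ → ℂ),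
      MvPolynomial.eval x (MvPolynomial.X 0 * g * ∏ i, initForm (η.f i)) ≠ 0 := by
    by_contra! h
    exact hne (MvPolynomial.funext_set _
      (fun _ => Set.infinite_range_of_injective Complex.ofReal_injective) (by simpa using h))
  choose u hu using fun k => hx k (Set.mem_univ k)
  obtain rfl : (fun k => (u k : ℂ)) = x := funext hu
  simp only [map_mul, map_prod, mul_ne_zero_iff, MvPolynomial.eval_X,
    Finset.prod_ne_zero_iff] at hxp
  obtain ⟨E, hE⟩ := exists_col_one_eq (Complex.ofReal_ne_zero.1 hxp.1.1)
  rw [← hE] at hxp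
  exact ⟨E, hg.adapted_iff.2 ⟨fun i => hxp.2 i (Finset.mem_univ i), hxp.1.2⟩⟩

end LogForm

section InitialForm

theorem HasLeadForm.ord_eq {n : ℕ} {f : O} {p : MvPolynomial (Fin 2) ℂ} (h : HasLeadForm n f p)
    (hp : p ≠ 0) : ord f = n := by
  have hle : (f : Ser).order ≤ n := not_lt.1 fun hlt =>
    hp (by rw [← h.homPart_eq, homPart_eq_zero hlt])
  rw [ord, le_antisymm hle h.le_order, ENat.toNat_natCast]

theorem HasLeadForm.initForm_eq {n : ℕ} {f : O} {p : MvPolynomial (Fin 2) ℂ}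
    (h : HasLeadForm n f p) (hp : p ≠ 0) : initForm f = p := by
  rw [← h.homPart_eq, ← h.ord_eq hp]
  rfl

theorem initForm_ne_zero {f : O} (hf : f ≠ 0) : initForm f ≠ 0 :=
  (hasLeadForm_initForm hf).ne_zero_of_order_eq (order_eq_ord hf).symm

theorem initForm_one : initForm 1 = 1 :=
  HasLeadForm.initForm_eq (n := 0)
    (by simpa using hasLeadForm_coe_of_isHomogeneous (MvPolynomial.isHomogeneous_one (Fin 2) ℂ))
    one_ne_zero

theorem initForm_mul {f g : O} (hf : f ≠ 0) (hg : g ≠ 0) :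
    initForm (f * g) = initForm f * initForm g :=
  ((hasLeadForm_initForm hf).mul (hasLeadForm_initForm hg)).initForm_eq
    (mul_ne_zero (initForm_ne_zero hf) (initForm_ne_zero hg))

theorem associated_initForm {f g : O} (hf : f ≠ 0) (h : Associated f g) :
    Associated (initForm f) (initForm g) := by
  obtain ⟨u, rfl⟩ := h
  rw [initForm_mul hf u.ne_zero]
  refine associated_mul_unit_right _ _ (IsUnit.of_mul_eq_one (initForm ((u⁻¹ : Oˣ) : O)) ?_)
  rw [← initForm_mul u.ne_zero u⁻¹.ne_zero, Units.mul_inv, initForm_one]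

theorem associated_conePoly (E : GL (Fin 2) ℝ) {f g : O} (hf : f ≠ 0) (h : Associated f g) :
    Associated (conePoly E f) (conePoly E g) :=
  (associated_initForm hf h).map (lineEval (col E 0) (col E 1))

end InitialForm

section Conjugation

/-- Complex conjugation of germs as a ring homomorphism. -/
def conjHom : O →+* O :=
  (MvPowerSeries.map (starRingEnd ℂ)).restrict O O fun f hf => (conj ⟨f, hf⟩).2

theorem conjHom_apply (f : O) : conjHom f = conj f := rfl

theorem conj_conj (f : O) : conj (conj f) = f := by
  apply Subtype.ext
  ext d
  simp [conj]

theorem associated_conj_iff {f g : O} : Associated (conj f) (conj g) ↔ Associated f g := by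
  have h : ∀ {f g : O}, Associated f g → Associated (conj f) (conj g) := fun h => h.map conjHom
  exact ⟨fun hc => by simpa only [conj_conj] using h hc, h⟩

theorem conj_ne_zero {f : O} (hf : f ≠ 0) : conj f ≠ 0 := fun h => hf (by
  rw [← conj_conj f, h, ← conjHom_apply, map_zero])

theorem HasLeadForm.map {n : ℕ} {f : Ser} {p : MvPolynomial (Fin 2) ℂ} (h : HasLeadForm n f p)
    (φ : ℂ →+* ℂ) : HasLeadForm n (MvPowerSeries.map φ f) (MvPolynomial.map φ p) := by
  refine ⟨h.le_order.trans (MvPowerSeries.le_order_map φ), ?_⟩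
  ext d
  rw [← h.homPart_eq, coeff_homPart, MvPolynomial.coeff_map, coeff_homPart,
    MvPowerSeries.coeff_map, apply_ite φ, map_zero]

theorem initForm_conj {f : O} (hf : f ≠ 0) :
    initForm (conj f) = MvPolynomial.map (starRingEnd ℂ) (initForm f) :=
  ((hasLeadForm_initForm hf).map (starRingEnd ℂ)).initForm_eq (f := conj f)
    ((MvPolynomial.map_injective _ (starRingEnd ℂ).injective).ne_iff' (map_zero _) |>.2
      (initForm_ne_zero hf))

theorem lineEval_map (φ : ℂ →+* ℂ) {v w : Fin 2 → ℂ} (hv : ∀ k, φ (v k) = v k)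
    (hw : ∀ k, φ (w k) = w k) (p : MvPolynomial (Fin 2) ℂ) :
    lineEval v w (MvPolynomial.map φ p) = (lineEval v w p).map φ := by
  induction p using MvPolynomial.induction_on with
  | C a => simp
  | add p q hp hq => simp [hp, hq]
  | mul_X p k hp => simp [hp, lineEval_X, hv, hw]

theorem conePoly_conj (E : GL (Fin 2) ℝ) {f : O} (hf : f ≠ 0) :
    conePoly E (conj f) = (conePoly E f).map (starRingEnd ℂ) := by
  rw [conePoly_eq_lineEval, initForm_conj hf, lineEval_map] <;> simp [conePoly_eq_lineEval, col]

theorem roots_conePoly_of_associated_conj (E : GL (Fin 2) ℝ) {f g : O} (hf : f ≠ 0)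
    (h : Associated (conj f) g) :
    (conePoly E g).roots = (conePoly E f).roots.map (starRingEnd ℂ) := by
  rw [← (associated_conePoly E (conj_ne_zero hf) h).roots_eq, conePoly_conj E hf,
    (IsAlgClosed.splits _).roots_map]

theorem exists_map_ofRealHom_eq {p : ℂ[X]} (h : p.map (starRingEnd ℂ) = p) :
    ∃ q : ℝ[X], q.map Complex.ofRealHom = p := by
  refine (mem_lifts p).1 ((lifts_iff_coeff_lifts p).2 fun n => ?_)
  have hcoeff := congrArg (fun q => q.coeff n) h
  simp only [coeff_map] at hcoeff
  obtain ⟨r, hr⟩ := Complex.conj_eq_iff_real.1 hcoeff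
  exact ⟨r, hr.symm⟩

end Conjugation

namespace LogForm

variable {ι : Type*} {η : LogForm ι}

/-- The poles of `η`, with their residues, are invariant by complex conjugation. This is the part of
`IsSymmetric` which does not involve the holomorphic part of `η`. -/
def HasConjInvariantPoles (η : LogForm ι) : Prop :=
  ∀ i, ∃ j, Associated (conj (η.f i)) (η.f j) ∧ η.res j = starRingEnd ℂ (η.res i)

namespace HasConjInvariantPoles

theorem exists_perm [Finite ι] (h : η.HasConjInvariantPoles) :
    ∃ σ : Equiv.Perm ι, ∀ i, Associated (conj (η.f i)) (η.f (σ i)) ∧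
      η.res (σ i) = starRingEnd ℂ (η.res i) := by
  choose σ hσ using h
  have hinj : Function.Injective σ := fun i j hij => by
    by_contra hne
    exact η.distinct i j hne (associated_conj_iff.1 ((hσ i).1.trans (hij ▸ (hσ j).1.symm)))
  exact ⟨Equiv.ofBijective σ (Finite.injective_iff_bijective.1 hinj), hσ⟩

variable [Fintype ι]

theorem rho_conj (h : η.HasConjInvariantPoles) (E : GL (Fin 2) ℝ) (a : ℂ) :
    η.rho E (starRingEnd ℂ a) = starRingEnd ℂ (η.rho E a) := by
  obtain ⟨σ, hσ⟩ := h.exists_perm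
  rw [rho, rho, map_sum, ← Equiv.sum_comp σ]
  refine Finset.sum_congr rfl fun i _ => ?_
  rw [(hσ i).2, map_mul, map_natCast, ← count_roots, ← count_roots,
    roots_conePoly_of_associated_conj E (η.irreducible i).ne_zero (hσ i).1,
    Multiset.count_map_eq_count' _ _ (starRingEnd ℂ).injective]

theorem conj_mem_cone (h : η.HasConjInvariantPoles) {E : GL (Fin 2) ℝ} {a : ℂ}
    (ha : a ∈ η.cone E) : starRingEnd ℂ a ∈ η.cone E := by
  obtain ⟨i, hi⟩ := mem_cone.1 ha
  obtain ⟨j, hj, -⟩ := h i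
  refine mem_cone.2 ⟨j, ?_⟩
  rw [roots_conePoly_of_associated_conj E (η.irreducible i).ne_zero hj]
  exact Multiset.mem_map_of_mem _ hi

theorem image_conj_cone (h : η.HasConjInvariantPoles) (E : GL (Fin 2) ℝ) :
    (η.cone E).image (starRingEnd ℂ) = η.cone E :=
  Finset.eq_of_subset_of_card_le (Finset.image_subset_iff.2 fun _ => h.conj_mem_cone)
    (Finset.card_image_of_injective _ (starRingEnd ℂ).injective).ge

theorem exists_map_eq_escapePoly (h : η.HasConjInvariantPoles) (E : GL (Fin 2) ℝ) :
    ∃ P : ℝ[X], P.map Complex.ofRealHom = η.escapePoly E := by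
  have hmap := map_polarNum (starRingEnd ℂ).injective (S := η.cone E) fun a _ => h.rho_conj E a
  rw [h.image_conj_cone] at hmap
  exact exists_map_ofRealHom_eq hmap

theorem exists_map_eq_nodal_cone (h : η.HasConjInvariantPoles) (E : GL (Fin 2) ℝ) :
    ∃ Q : ℝ[X], Q.map Complex.ofRealHom = nodal (η.cone E) id :=
  exists_map_ofRealHom_eq (by rw [map_nodal (starRingEnd ℂ).injective, h.image_conj_cone])

end HasConjInvariantPoles

end LogForm

section SmoothBranches

theorem homPart_one (f : Ser) : homPart 1 f =
    MvPolynomial.C (MvPowerSeries.coeff (Finsupp.single 0 1) f) * MvPolynomial.X 0 +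
      MvPolynomial.C (MvPowerSeries.coeff (Finsupp.single 1 1) f) * MvPolynomial.X 1 := by
  have h : (Finset.HasAntidiagonal.antidiagonal 1 : Finset (ℕ × ℕ)) = {(0, 1), (1, 0)} := rfl
  rw [homPart, h, Finset.sum_pair (by simp), add_comm]
  simp [MvPolynomial.C_mul_X_eq_monomial]

variable {f : O}

theorem ord_eq_one (hf : (f : Ser).order = 1) : ord f = 1 := by
  rw [ord, hf, ENat.toNat_one]

theorem ne_zero_of_order_eq_one (hf : (f : Ser).order = 1) : f ≠ 0 := by
  rintro rfl
  simp at hf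

variable {E : GL (Fin 2) ℝ} {a : ℂ}

theorem eval_initForm_ne_zero_of_order_eq_one (hf : (f : Ser).order = 1)
    (ha : (conePoly E f).IsRoot a) : MvPolynomial.eval (col E 1) (initForm f) ≠ 0 := by
  intro h₁
  have hne := initForm_ne_zero (ne_zero_of_order_eq_one hf)
  rw [IsRoot, conePoly_eq_lineEval, eval_lineEval] at ha
  have hlin : initForm f = homPart 1 f := by rw [← ord_eq_one hf]; rfl
  rw [hlin, homPart_one] at h₁ ha hne
  set α := MvPowerSeries.coeff (Finsupp.single 0 1) (f : Ser)
  set β := MvPowerSeries.coeff (Finsupp.single 1 1) (f : Ser)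
  simp only [map_add, map_mul, MvPolynomial.eval_C, MvPolynomial.eval_X, Pi.add_apply,
    Pi.smul_apply, smul_eq_mul] at h₁ ha
  have hα : (col E 0 0 * col E 1 1 - col E 1 0 * col E 0 1) * α = 0 := by
    linear_combination col E 1 1 * ha - (col E 0 1 + a * col E 1 1) * h₁
  have hβ : (col E 0 0 * col E 1 1 - col E 1 0 * col E 0 1) * β = 0 := by
    linear_combination (col E 0 0 + a * col E 1 0) * h₁ - col E 1 0 * ha
  rw [(mul_eq_zero.1 hα).resolve_left (det_col_ne_zero E),
    (mul_eq_zero.1 hβ).resolve_left (det_col_ne_zero E)] at hne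
  simp at hne

theorem roots_conePoly_of_order_eq_one (hf : (f : Ser).order = 1) (ha : (conePoly E f).IsRoot a) :
    (conePoly E f).roots = {a} := by
  have hf0 := ne_zero_of_order_eq_one hf
  have he := eval_initForm_ne_zero_of_order_eq_one hf ha
  refine (Multiset.eq_of_le_of_card_le
    (Multiset.singleton_le.2 ((mem_roots (conePoly_ne_zero hf0 he)).2 ha)) ?_).symm
  rw [Multiset.card_singleton, ← ord_eq_one hf, ← natDegree_conePoly hf0 he]
  exact card_roots' _

theorem eq_of_associated_of_order_eq_one {g : O} {b : ℂ} (hf : (f : Ser).order = 1)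
    (ha : (conePoly E f).IsRoot a) (hg : (g : Ser).order = 1) (hb : (conePoly E g).IsRoot b)
    (h : Associated f g) : a = b := by
  have hroots := (associated_conePoly E (ne_zero_of_order_eq_one hf) h).roots_eq
  rwa [roots_conePoly_of_order_eq_one hf ha, roots_conePoly_of_order_eq_one hg hb,
    Multiset.singleton_inj] at hroots

end SmoothBranches

section Lines

/-- The linear form which vanishes on the line spanned by `v`. -/
def lineGerm (v : Fin 2 → ℂ) : O :=
  ⟨MvPowerSeries.C (v 1) * MvPowerSeries.X 0 + MvPowerSeries.C (-v 0) * MvPowerSeries.X 1,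
    ((converges_C _).mul (converges_X 0)).add ((converges_C _).mul (converges_X 1))⟩

theorem hasLeadForm_lineGerm (v : Fin 2 → ℂ) :
    HasLeadForm 1 (lineGerm v) (v 1 • MvPolynomial.X 0 + (-v 0) • MvPolynomial.X 1) := by
  have h := ((hasLeadForm_X 0).smul (v 1)).add ((hasLeadForm_X 1).smul (-v 0))
  rwa [MvPowerSeries.smul_eq_C_mul, MvPowerSeries.smul_eq_C_mul] at h

theorem leadForm_lineGerm_ne_zero {v : Fin 2 → ℂ} (hv : v ≠ 0) :
    v 1 • MvPolynomial.X 0 + (-v 0) • MvPolynomial.X 1 ≠ (0 : MvPolynomial (Fin 2) ℂ) := by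
  refine fun h => hv (funext fun k => ?_)
  have h₀ := congrArg (MvPolynomial.eval ![1, 0]) h
  have h₁ := congrArg (MvPolynomial.eval ![0, 1]) h
  fin_cases k
  · simpa using h₁
  · simpa using h₀

theorem order_lineGerm {v : Fin 2 → ℂ} (hv : v ≠ 0) : (lineGerm v : Ser).order = 1 := by
  have h := hasLeadForm_lineGerm v
  have hne := leadForm_lineGerm_ne_zero hv
  rw [order_eq_ord, h.ord_eq hne, Nat.cast_one]
  intro h0
  rw [h0] at h
  exact hne (by rw [← h.homPart_eq, homPart_eq_zero (by simp)])

theorem conj_lineGerm {v : Fin 2 → ℂ} (hv : ∀ k, starRingEnd ℂ (v k) = v k) :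
    conj (lineGerm v) = lineGerm v := by
  apply Subtype.ext
  simp [conj, lineGerm, hv]

theorem col_add_smul_col_ne_zero (E : GL (Fin 2) ℝ) (a : ℂ) : col E 0 + a • col E 1 ≠ 0 := by
  intro h
  have h₀ := congrFun h 0
  have h₁ := congrFun h 1
  simp only [Pi.add_apply, Pi.smul_apply, smul_eq_mul, Pi.zero_apply] at h₀ h₁
  exact det_col_ne_zero E (by linear_combination col E 1 1 * h₀ - col E 1 0 * h₁)

theorem isRoot_conePoly_lineGerm (E : GL (Fin 2) ℝ) (a : ℂ) :
    (conePoly E (lineGerm (col E 0 + a • col E 1))).IsRoot a := by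
  rw [IsRoot, conePoly_eq_lineEval, eval_lineEval, (hasLeadForm_lineGerm _).initForm_eq
    (leadForm_lineGerm_ne_zero (col_add_smul_col_ne_zero E a))]
  simp only [map_add, MvPolynomial.smul_eval, MvPolynomial.eval_X]
  ring

end Lines

namespace LogForm

variable {ι : Type*} [Fintype ι] {η : LogForm ι} {E : GL (Fin 2) ℝ} {s : ℕ} {τ : Fin s → ℂ × ℂ}
  {η' : LogForm (ι ⊕ Fin s)}

theorem rho_eq_zero {a : ℂ} (ha : a ∉ η.cone E) : η.rho E a = 0 := by
  refine Finset.sum_eq_zero fun i _ => ?_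
  rw [← count_roots, Multiset.count_eq_zero.2 fun h => ha (mem_cone.2 ⟨i, h⟩), Nat.cast_zero,
    mul_zero]

namespace IsModification

theorem roots_inr (h : η.IsModification E τ η') (i : Fin s) :
    (conePoly E (η'.f (Sum.inr i))).roots = {(τ i).1} :=
  roots_conePoly_of_order_eq_one (h.smooth i) (h.tangent i)

theorem eval_initForm_ne_zero (h : η.IsModification E τ η')
    (he : ∀ i, MvPolynomial.eval (col E 1) (initForm (η.f i)) ≠ 0) :
    ∀ i, MvPolynomial.eval (col E 1) (initForm (η'.f i)) ≠ 0 := by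
  rintro (i | i)
  · rw [h.f_inl]
    exact he i
  · exact eval_initForm_ne_zero_of_order_eq_one (h.smooth i) (h.tangent i)

theorem mainResonant (h : η.IsModification E τ η') (hres : η.MainResonant)
    (hsum : ∑ i, (τ i).2 = 0) : η'.MainResonant := by
  rw [MainResonant, Fintype.sum_sum_type]
  simp only [h.f_inl, h.res_inl, h.res_inr, ord_eq_one (h.smooth _), Nat.cast_one, one_mul, hsum,
    add_zero]
  exact hres

theorem cone_eq (h : η.IsModification E τ η') :
    η'.cone E = η.cone E ∪ Finset.univ.image fun i => (τ i).1 := by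
  ext a
  rw [mem_cone, Finset.mem_union, mem_cone, Finset.mem_image, Sum.exists]
  simp only [h.f_inl, h.roots_inr, Multiset.mem_singleton, Finset.mem_univ, true_and,
    eq_comm (a := a)]

theorem disjoint_cone (h : η.IsModification E τ η') :
    Disjoint (η.cone E) (Finset.univ.image fun i => (τ i).1) := by
  rw [Finset.disjoint_right]
  intro a ha
  obtain ⟨i, -, rfl⟩ := Finset.mem_image.1 ha
  exact h.params.2.1 i

theorem card_cone (h : η.IsModification E τ η') : (η'.cone E).card = (η.cone E).card + s := by
  rw [h.cone_eq, Finset.card_union_of_disjoint h.disjoint_cone,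
    Finset.card_image_of_injective _ h.params.1, Finset.card_fin]

theorem rho_eq (h : η.IsModification E τ η') (a : ℂ) :
    η'.rho E a = η.rho E a + ∑ i, if (τ i).1 = a then (τ i).2 else 0 := by
  rw [rho, rho, Fintype.sum_sum_type]
  simp only [h.f_inl, h.res_inl, h.res_inr, ← count_roots, h.roots_inr, Multiset.count_singleton,
    Nat.cast_ite, Nat.cast_one, Nat.cast_zero, mul_ite, mul_one, mul_zero, eq_comm (a := a)]

theorem rho_of_mem_cone (h : η.IsModification E τ η') {a : ℂ} (ha : a ∈ η.cone E) :
    η'.rho E a = η.rho E a := by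
  rw [h.rho_eq, Finset.sum_eq_zero, add_zero]
  exact fun i _ => if_neg fun hi : (τ i).1 = a => h.params.2.1 i (hi ▸ ha)

theorem rho_param (h : η.IsModification E τ η') (i : Fin s) : η'.rho E (τ i).1 = (τ i).2 := by
  rw [h.rho_eq, rho_eq_zero (h.params.2.1 i), zero_add]
  simp only [h.params.1.eq_iff, Finset.sum_ite_eq', Finset.mem_univ, if_true]

theorem escapePoly_eq (h : η.IsModification E τ η') {d : ℂ → ℂ} (hd : ∀ i, d (τ i).1 = (τ i).2) :
    η'.escapePoly E = addPolesNum (η.escapePoly E) (nodal (η.cone E) id)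
      (Finset.univ.image fun i => (τ i).1) d := by
  have hη : polarNum (η.cone E) (η'.rho E) = η.escapePoly E :=
    polarNum_congr fun a ha => h.rho_of_mem_cone ha
  have hη' : η'.escapePoly E = polarNum (η'.cone E) (η'.rho E) := rfl
  rw [hη', h.cone_eq, polarNum_union_eq_addPolesNum h.disjoint_cone, hη]
  refine addPolesNum_congr _ _ fun a ha => ?_
  obtain ⟨i, -, rfl⟩ := Finset.mem_image.1 ha
  rw [h.rho_param, hd]

end IsModification

namespace IsParameterSet

/-- The modification of `η` by the smooth branches `g i = 0`. -/
def addBranches (hτ : η.IsParameterSet E τ) {g : Fin s → O} (hg : ∀ i, (g i : Ser).order = 1)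
    (hroot : ∀ i, (conePoly E (g i)).IsRoot (τ i).1) : LogForm (ι ⊕ Fin s) :=
  have hmixed : ∀ i j, ¬ Associated (η.f i) (g j) := fun i j h => hτ.2.1 j (mem_cone.2 ⟨i, by
    rw [(associated_conePoly E (η.irreducible i).ne_zero h).roots_eq,
      roots_conePoly_of_order_eq_one (hg j) (hroot j)]
    exact Multiset.mem_singleton_self _⟩)
  { f := Sum.elim η.f g
    res := Sum.elim η.res fun i => (τ i).2
    αx := η.αx
    αy := η.αy
    irreducible := Sum.rec η.irreducible fun i => irreducible_of_order_eq_one (hg i)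
    distinct := by
      rintro (i | i) (j | j) hij h
      · exact η.distinct i j (fun hij' => hij (congrArg _ hij')) h
      · exact hmixed i j h
      · exact hmixed j i h.symm
      · exact hij (congrArg _ (hτ.1 (eq_of_associated_of_order_eq_one (hg i) (hroot i) (hg j)
          (hroot j) h)))
    res_ne_zero := Sum.rec η.res_ne_zero hτ.2.2
    closed := η.closed }

theorem isModification_addBranches (hτ : η.IsParameterSet E τ) {g : Fin s → O}
    (hg : ∀ i, (g i : Ser).order = 1) (hroot : ∀ i, (conePoly E (g i)).IsRoot (τ i).1) :
    η.IsModification E τ (hτ.addBranches hg hroot) where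
  params := hτ
  f_inl _ := rfl
  res_inl _ := rfl
  αx_eq := rfl
  αy_eq := rfl
  res_inr _ := rfl
  smooth := hg
  tangent := hroot

theorem exists_isSymmetricModification (hτ : η.IsParameterSet E τ)
    (hreal : ∀ i, starRingEnd ℂ (τ i).1 = (τ i).1 ∧ starRingEnd ℂ (τ i).2 = (τ i).2) :
    ∃ η' : LogForm (ι ⊕ Fin s), η.IsSymmetricModification E τ η' := by
  refine ⟨hτ.addBranches (g := fun i => lineGerm (col E 0 + (τ i).1 • col E 1))
    (fun i => order_lineGerm (col_add_smul_col_ne_zero E _))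
    (fun i => isRoot_conePoly_lineGerm E _), hτ.isModification_addBranches _ _,
    fun i => ⟨i, Prod.ext (hreal i).1.symm (hreal i).2.symm⟩,
    fun i => ⟨i, (conj_lineGerm fun k => ?_).symm⟩⟩
  simp [col, (hreal i).1]

end IsParameterSet

end LogForm

section RealParameters

theorem eval_map_ofRealHom (p : ℝ[X]) (t : ℝ) :
    (p.map Complex.ofRealHom).eval (t : ℂ) = ((p.eval t : ℝ) : ℂ) :=
  eval_map_apply Complex.ofRealHom t

/-- The set of parameters of a modification which has the residue `l a` at each real point `a ∈ S`,
indexed by `Fin S.card`. -/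
def realParams (S : Finset ℝ) (l : ℝ → ℚ) (i : Fin S.card) : ℂ × ℂ :=
  (((S.equivFin.symm i : ℝ) : ℂ), (l (S.equivFin.symm i) : ℂ))

theorem image_fst_realParams (S : Finset ℝ) (l : ℝ → ℚ) :
    (Finset.univ.image fun i => (realParams S l i).1) = S.image Complex.ofRealHom := by
  ext z
  simp only [realParams, Finset.mem_image, Finset.mem_univ, true_and]
  rw [S.equivFin.symm.exists_congr_left, Subtype.exists]
  simp

theorem sum_snd_realParams (S : Finset ℝ) (l : ℝ → ℚ) :
    ∑ i, (realParams S l i).2 = ((∑ a ∈ S, l a : ℚ) : ℂ) := by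
  rw [Rat.cast_sum, ← Finset.sum_coe_sort S, ← Equiv.sum_comp S.equivFin.symm]
  rfl

end RealParameters

namespace LogForm

variable {ι : Type*} [Fintype ι] {η : LogForm ι} {E : GL (Fin 2) ℝ} {S : Finset ℝ} {l : ℝ → ℚ}

theorem isParameterSet_realParams (hS : ∀ a ∈ S, (a : ℂ) ∉ η.cone E) (hl : ∀ a ∈ S, l a ≠ 0) :
    η.IsParameterSet E (realParams S l) :=
  ⟨Complex.ofReal_injective.comp (Subtype.val_injective.comp S.equivFin.symm.injective),
    fun i => hS _ (S.equivFin.symm i).2,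
    fun i => Rat.cast_ne_zero.2 (hl _ (S.equivFin.symm i).2)⟩

theorem IsModification.escapePoly_eq_map {η' : LogForm (ι ⊕ Fin S.card)}
    (h : η.IsModification E (realParams S l) η') {P Q : ℝ[X]}
    (hP : P.map Complex.ofRealHom = η.escapePoly E)
    (hQ : Q.map Complex.ofRealHom = nodal (η.cone E) id) :
    η'.escapePoly E = (addPolesNum P Q S fun a => (l a : ℝ)).map Complex.ofRealHom := by
  rw [h.escapePoly_eq (d := fun z => (l z.re : ℂ)) fun i => by simp [realParams],
    image_fst_realParams,
    map_addPolesNum Complex.ofRealHom.injective P Q (d := fun z => (l z.re : ℂ)) (by simp), hP, hQ]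

theorem IsModification.adapted {s : ℕ} {τ : Fin s → ℂ × ℂ} {η' : LogForm (ι ⊕ Fin s)}
    (h : η.IsModification E τ η') (hE : η.Adapted E) (hbal : η.IsBalanced E τ η') :
    η'.Adapted E :=
  ⟨h.eval_initForm_ne_zero hE.1, hbal.2.1, by rw [hbal.2.2, h.card_cone]⟩

theorem HasConjInvariantPoles.exists_realParams (hη : η.HasConjInvariantPoles) (hE : η.Adapted E)
    {ε : ℝ} (hε : 0 < ε) :
    ∃ (S : Finset ℝ) (l : ℝ → ℚ), S.Nonempty ∧ IsSmallBalanced ε S l ∧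
      η.IsParameterSet E (realParams S l) ∧
      ∀ η' : LogForm (ι ⊕ Fin S.card), η.IsModification E (realParams S l) η' →
        η.IsBalanced E (realParams S l) η' ∧
          ∀ t : ℝ, (t : ℂ) ∉ η'.cone E → (η'.escapePoly E).eval (t : ℂ) ≠ 0 := by
  obtain ⟨P, hP⟩ := hη.exists_map_eq_escapePoly E
  obtain ⟨Q, hQ⟩ := hη.exists_map_eq_nodal_cone E
  have hPdeg : P.natDegree + 2 = (η.cone E).card := by rw [← hE.2.2, ← hP, natDegree_map]
  have hQdeg : Q.natDegree = (η.cone E).card := by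
    rw [← natDegree_map Complex.ofRealHom, hQ, natDegree_nodal]
  have hP0 : P ≠ 0 := by
    rintro rfl
    exact hE.2.1 (by rw [← hP, Polynomial.map_zero])
  have hQ0 : Q ≠ 0 := by
    rintro rfl
    exact nodal_ne_zero (by rw [← hQ, Polynomial.map_zero])
  have hQcone : ∀ t : ℝ, Q.eval t = 0 ↔ (t : ℂ) ∈ η.cone E := fun t => by
    rw [← eval_nodal_eq_zero_iff, ← hQ, eval_map_ofRealHom, Complex.ofReal_eq_zero]
  obtain ⟨S, l, hne, hS, hl, hdeg, heval⟩ := exists_isSmallBalanced_forall_eval_ne_zero hP0 hQ0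
    (by omega) (finite_setOfPred_isRoot hQ0) hε
  refine ⟨S, l, hne, hl, isParameterSet_realParams (fun a ha haE =>
    Set.disjoint_left.1 hS ha ((hQcone a).2 haE)) hl.ne_zero, fun η' h => ?_⟩
  have hesc := h.escapePoly_eq_map hP hQ
  refine ⟨⟨by rw [sum_snd_realParams, hl.sum_eq_zero, Rat.cast_zero], ?_, ?_⟩, fun t ht => ?_⟩
  · rw [hesc]
    refine (Polynomial.map_ne_zero_iff Complex.ofRealHom.injective).2
      (ne_zero_of_natDegree_gt (n := 0) ?_)
    rw [hdeg]
    exact Nat.add_pos_right _ hne.card_pos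
  · rw [hesc, natDegree_map, hdeg]
    omega
  · rw [h.cone_eq, Finset.mem_union, not_or] at ht
    rw [hesc, eval_map_ofRealHom, Complex.ofReal_ne_zero]
    exact heval t fun h0 => ht.1 ((hQcone t).1 h0)

end LogForm

end LogModel

end

theorem mainTheorem9_general {ι : Type*} [Fintype ι] (η : LogModel.LogForm ι)
    (hpoles : η.HasConjInvariantPoles) (hres : η.MainResonant) (hfaith : η.OneFaithful) :
    (∃ E : GL (Fin 2) ℝ, η.Adapted E) ∧
    ∀ E : GL (Fin 2) ℝ, η.Adapted E → ∀ ε : ℝ, 0 < ε →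
      ∃ (s : ℕ) (a : Fin s → ℝ) (l : Fin s → ℚ) (τ : Fin s → ℂ × ℂ),
        0 < s ∧ (∀ i, τ i = ((a i : ℂ), (l i : ℂ))) ∧ (∀ i, |(l i : ℝ)| < ε) ∧
        (∃ η' : LogModel.LogForm (ι ⊕ Fin s), η.IsSymmetricModification E τ η') ∧
        ∀ η' : LogModel.LogForm (ι ⊕ Fin s), η.IsModification E τ η' →
          η.IsBalanced E τ η' ∧ η'.NoRealEscapePoints := by
  refine ⟨LogModel.LogForm.exists_adapted hres hfaith, fun E hE ε hε => ?_⟩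
  obtain ⟨S, l, hne, hl, hτ, hmod⟩ := hpoles.exists_realParams hE hε
  refine ⟨S.card, fun i => S.equivFin.symm i, fun i => l (S.equivFin.symm i),
    LogModel.realParams S l, hne.card_pos, fun _ => rfl,
    fun i => hl.abs_lt _ (S.equivFin.symm i).2, hτ.exists_isSymmetricModification ?_,
    fun η' h => ?_⟩
  · simp [LogModel.realParams]
  · obtain ⟨hbal, heval⟩ := hmod η' h
    obtain ⟨g, hg⟩ := (h.mainResonant hres hbal.1).exists_isRadialFactor
    exact ⟨hbal, hg.noRealEscapePoints (h.adapted hE hbal) heval⟩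

theorem mainTheorem9 {ι : Type*} [Fintype ι] (η : LogModel.LogForm ι)
    (hsymm : η.IsSymmetric) (hres : η.MainResonant) (hfaith : η.OneFaithful) :
    (∃ E : GL (Fin 2) ℝ, η.Adapted E) ∧
    ∀ E : GL (Fin 2) ℝ, η.Adapted E → ∀ ε : ℝ, 0 < ε →
      ∃ (s : ℕ) (a : Fin s → ℝ) (l : Fin s → ℚ) (τ : Fin s → ℂ × ℂ),
        0 < s ∧ (∀ i, τ i = ((a i : ℂ), (l i : ℂ))) ∧ (∀ i, |(l i : ℝ)| < ε) ∧
        (∃ η' : LogModel.LogForm (ι ⊕ Fin s), η.IsSymmetricModification E τ η') ∧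
        ∀ η' : LogModel.LogForm (ι ⊕ Fin s), η.IsSymmetricModification E τ η' →
          η.IsBalanced E τ η' ∧ η'.NoRealEscapePoints := by
  obtain ⟨hadapted, hmod⟩ := mainTheorem9_general η hsymm.1 hres hfaith
  refine ⟨hadapted, fun E hE ε hε => ?_⟩
  obtain ⟨s, a, l, τ, hs, hτ, hl, hex, hall⟩ := hmod E hE ε hε
  exact ⟨s, a, l, τ, hs, hτ, hl, hex, fun η' h => hall η' h.toIsModification⟩
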